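/- **Proposition (empty or dense).** Let $\mathbb{Z}^2_{\mathrm{even}}=\{(x,t)\in\mathbb{Z}^2 : x+t \text{ is even}\}$. Assign to each $z\in\mathbb{Z}^2_{\mathrm{even}}$ a symmetric $\pm1$-valued initial arrow and a rate one Poisson clock; whenever the clock at $z$ rings, the arrow at $z$ is replaced by a new symmetric $\pm 1$-valued arrow, all clocks and all (initial and new) arrows being independent. Let $\xi_z^\tau$ be the resulting right-continuous arrow at $z$ at dynamical time $\tau\in[0,\infty)$, and let $S_0^\tau(t)$, $t\ge 0$ real, be the path started from $(0,0)$ that follows the arrows at dynamical time $\tau$, i.e. $S_0^\tau(0)=0$, $S_0^\tau(n+1)=S_0^\tau(n)+\xi^\tau_{(S_0^\tau(n),n)}$ for integers $n\ge0$, with linear interpolation between integer times. For $K>0$ define the set of eventually $K$-subdiffusive times $$\hat T^{\pm}(K)=\{\tau\in[0,\infty) : \exists N,j \text{ such that } |S_0^\tau(t)|\le j+K\sqrt t \text{ for all } t\ge N\}$$ (with $N,j$ non-negative integers) and the set of limit-$K$-subdiffusive times $$\tilde T^{\pm}(K)=\{\tau\in[0,\infty) : \limsup_{t\to\infty}|S_0^\tau(t)|/\sqrt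 t\le K\}.$$ Then, almost surely, for every $K>0$ simultaneously, each of the sets $\hat T^{\pm}(K)$ and $\tilde T^{\pm}(K)$ is either empty or dense in $[0,\infty)$. -/

import Mathlib

open MeasureTheory ProbabilityTheory Filter
open scoped NNReal

namespace DyDW

/-- The even sublattice `{(x, t) ∈ ℤ² : x + t even}`; first coordinate space, second time. -/
abbrev Site : Type := {p : ℤ × ℤ // Even (p.1 + p.2)}

/-- The site `(0, 0)`. -/
def origin : Site := ⟨(0, 0), by simp⟩

/-- An arrow configuration: at each site an arrow `+1` or `-1`. -/
abbrev Arrows : Type := Site → ℤˣ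

/-- The arrow at `(x, t)` leads to `(x + ξ (x, t), t + 1)`. -/
def step (ξ : Arrows) (z : Site) : Site :=
  ⟨(z.1.1 + (ξ z : ℤ), z.1.2 + 1), by
    have h := z.2
    rcases Int.units_eq_one_or (ξ z) with h1 | h1 <;>
      · rw [h1]
        simp only [Units.val_neg, Units.val_one]
        grind⟩

/-- The site reached from `z` after following `n` arrows. -/
def siteAfter (ξ : Arrows) (z : Site) (n : ℕ) : Site := (step ξ)^[n] z

/-- The space coordinate at real time `s` of the path that starts at `z = (x, t)` and follows
the arrows, moving along each arrow at unit speed. (For `s < t` the value is irrelevant.) -/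
noncomputable def path (ξ : Arrows) (z : Site) (s : ℝ) : ℝ :=
  let n : ℕ := ⌊s - (z.1.2 : ℝ)⌋₊
  let w : Site := siteAfter ξ z n
  (w.1.1 : ℝ) + (s - (w.1.2 : ℝ)) * ((ξ w : ℤ) : ℝ)

/-- The time of the `n`-th ring (counted from `n = 0`) of a clock with successive waiting
times `wait 0, wait 1, …`. -/
noncomputable def ringTime (wait : ℕ → ℝ) (n : ℕ) : ℝ := ∑ i ∈ Finset.range (n + 1), wait i

/-- The number of rings in the dynamical time interval `[0, τ]`. -/
noncomputable def ringCount (wait : ℕ → ℝ) (τ : ℝ≥0) : ℕ :=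
  {n : ℕ | ringTime wait n ≤ (τ : ℝ)}.ncard

/-- The arrow configuration at dynamical time `τ`: the initial arrow at `z` is `mark z 0`, and
the `n`-th ring of the clock at `z` (`n = 1, 2, …`) replaces the arrow by `mark z n`. -/
noncomputable def arrowsAt (wait : Site → ℕ → ℝ) (mark : Site → ℕ → ℤˣ) (τ : ℝ≥0) : Arrows :=
  fun z => mark z (ringCount (wait z) τ)

/-- `S₀^τ(t)`: the path from the origin in the web at dynamical time `τ`. -/
noncomputable def originPath (wait : Site → ℕ → ℝ) (mark : Site → ℕ → ℤˣ) (τ : ℝ≥0) (t : ℝ) : ℝ :=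
  path (arrowsAt wait mark τ) origin t

/-- The law of a symmetric `±1`-valued random variable. -/
noncomputable def signLaw : Measure ℤˣ := (PMF.uniformOfFintype ℤˣ).toMeasure

/-- The randomness that drives the dynamical discrete web: independent rate one Poisson clocks
at the sites (i.i.d. exponential waiting times of rate one between rings) and, independent of
the clocks, independent symmetric arrows (one initial arrow per site and one for each ring). -/
structure IsDriving {Ω : Type*} [MeasurableSpace Ω] (P : Measure Ω)
    (wait : Site → ℕ → Ω → ℝ) (mark : Site → ℕ → Ω → ℤˣ) : Prop where
  indep : iIndepFun (fun (i : Site × ℕ) ω => (wait i.1 i.2 ω, mark i.1 i.2 ω)) P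
  law : ∀ z n, HasLaw (fun ω => (wait z n ω, mark z n ω)) ((expMeasure 1).prod signLaw) P

/-- The dynamical times at which the path from the origin is `K`-subdiffusive eventually. -/
def eventuallySubdiffusive (wait : Site → ℕ → ℝ) (mark : Site → ℕ → ℤˣ) (K : ℝ) : Set ℝ≥0 :=
  {τ | ∃ N j : ℕ, ∀ t : ℝ, (N : ℝ) ≤ t → |originPath wait mark τ t| ≤ j + K * √t}

/-- The dynamical times at which the path from the origin is `K`-subdiffusive in the limit;
the upper limit is taken in the extended reals. -/
def limitSubdiffusive (wait : Site → ℕ → ℝ) (mark : Site → ℕ → ℤˣ) (K : ℝ) : Set ℝ≥0 :=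
  {τ | limsup (fun t : ℝ => ((|originPath wait mark τ t| / √t : ℝ) : EReal)) atTop ≤ (K : EReal)}

end DyDW

/-! Fix `K` and call a dynamical time exceptional if some path of the web at that time, from any
starting site, satisfies the bound in question. The bound is inherited along a path in both
directions, so the existence of an exceptional time in an interval depends only on the clocks at
arbitrarily late levels and has probability 0 or 1 (`IsPathProperty.measure_zero_or_one`). The
dynamics is stationary (`measurePreserving_shiftData`), so this probability depends only on the
length of the interval. Hence almost surely either there are no exceptional times, or every
nontrivial interval contains one (`IsPathProperty.dichotomy`).

To pass from some path to the path from the origin, `ae_coalesce_of_sub` shows that almost surely,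
at all dynamical times simultaneously, a subdiffusive path coalesces with every path from the same
level. Take two paths at distance `2 d` and a window of dynamical times of length `δ`. The extremal
paths built from all arrows present in the window stay apart with probability at most `4 d δ`. This
alone is too weak, since about `1/δ` windows cover a bounded interval. The missing small factor
comes from the first `m` steps: rings on them only contribute order `δ²`, and without rings the half
distance is a martingale while the midpoint is a lazy walk, which is unlikely to stay on one side of
a square-root curve. So a window costs `4 δ (d η + O(δ))` with `η` small for large `m`
(`measureReal_mixed_le`); letting `δ → 0` and then `m → ∞` gives probability 0.

Two uncountable families need care. The union over dynamical times is a projection of a Borel set,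
hence only universally measurable, and the zero-one law is proved for such sets. All `K` are treated
at once by monotonicity in `K` (`ae_forall_empty_or_dense`). -/

namespace DyDW

/-! ### Universal measurability of analytic sets. -/

section Analytic

open Topology

/-- A continuous image of Baire space can be approximated from inside, in outer measure, by the
images of compact boxes. -/
theorem exists_isCompact_subset_range {α : Type*} [TopologicalSpace α] [T2Space α]
    [MeasurableSpace α] [BorelSpace α] (μ : Measure α) [μ.OuterRegular]
    {f : (ℕ → ℕ) → α} (hf : Continuous f) {c : ENNReal} (hc : c < μ (Set.range f)) :
    ∃ C ⊆ Set.range f, IsCompact C ∧ c ≤ μ C := by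
  have next : ∀ (n : ℕ) (A : Set (ℕ → ℕ)), c < μ (f '' A) →
      ∃ k : ℕ, c < μ (f '' (A ∩ {x | x n ≤ k})) := by
    intro n A hA
    have hU : f '' A = ⋃ k : ℕ, f '' (A ∩ {x | x n ≤ k}) := by
      rw [← Set.image_iUnion, ← Set.inter_iUnion]
      congr 1
      ext x
      simp only [Set.mem_inter_iff, Set.mem_iUnion, Set.mem_ofPred_eq]
      exact ⟨fun h => ⟨h, x n, le_rfl⟩, fun h => h.1⟩
    have hmono : Monotone fun k : ℕ => f '' (A ∩ {x | x n ≤ k}) := by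
      intro k l hkl
      exact Set.image_mono (Set.inter_subset_inter_right _ fun x hx => le_trans hx hkl)
    rw [hU, hmono.measure_iUnion] at hA
    exact lt_iSup_iff.1 hA
  choose! k hk using next
  -- Coordinates are bounded one at a time, each time keeping the outer measure of the image above
  -- `c`.
  let A : ℕ → Set (ℕ → ℕ) := fun n => Nat.rec Set.univ (fun n A => A ∩ {x | x n ≤ k n A}) n
  have hA : ∀ n, c < μ (f '' A n) := by
    intro n
    induction n with
    | zero => simpa [A] using hc
    | succ n ih => exact hk n _ ih
  let b : ℕ → ℕ := fun n => k n (A n)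
  have hAb : ∀ n x, x ∈ A n ↔ ∀ i < n, x i ≤ b i := by
    intro n
    induction n with
    | zero => intro x; simp [A]
    | succ n ih =>
      intro x
      have : x ∈ A (n + 1) ↔ x ∈ A n ∧ x n ≤ b n := Iff.rfl
      rw [this, ih, Nat.forall_lt_succ_right]
  let K : Set (ℕ → ℕ) := Set.univ.pi fun i => Set.Iic (b i)
  have hK : IsCompact K := isCompact_univ_pi fun i => (Set.finite_Iic (b i)).isCompact
  refine ⟨f '' K, Set.image_subset_range _ _, hK.image hf, ?_⟩
  rw [Set.measure_eq_iInf_isOpen]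
  refine le_iInf₂ fun U hU => le_iInf fun hUo => ?_
  -- Compactness of the box replaces continuity from above along the images `f '' A n`, which need
  -- not be measurable.
  suffices h : ∃ n, A n ⊆ f ⁻¹' U by
    obtain ⟨n, hn⟩ := h
    exact (hA n).le.trans (measure_mono (Set.image_subset_iff.2 hn))
  by_contra! hcon
  have hx : ∀ n, ∃ x ∈ A n, x ∉ f ⁻¹' U := fun n => Set.not_subset.1 (hcon n)
  choose x hxA hxU using hx
  -- Truncation moves `x n` into the compact box without changing its coordinates below `n`, so both
  -- sequences have the same subsequential limits.
  let y : ℕ → ℕ → ℕ := fun n i => min (x n i) (b i)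
  have hy : ∀ n, y n ∈ K := fun n i _ => Set.mem_Iic.2 (min_le_right _ _)
  obtain ⟨z, hz, φ, hφ, hlim⟩ := hK.tendsto_subseq hy
  have hxlim : Tendsto (x ∘ φ) atTop (𝓝 z) := by
    rw [tendsto_pi_nhds] at hlim ⊢
    intro i
    refine (hlim i).congr' ?_
    filter_upwards [eventually_gt_atTop i] with n hn
    have h := (hAb _ _).1 (hxA (φ n)) i (hn.trans_le (hφ.id_le n))
    simp [y, h]
  have hzU : z ∈ f ⁻¹' U := hU (Set.mem_image_of_mem f hz)
  obtain ⟨n, hn⟩ := (hxlim.eventually ((hUo.preimage hf).mem_nhds hzU)).exists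
  exact hxU _ hn

/-- Analytic sets are universally measurable. -/
theorem nullMeasurableSet_of_analyticSet {α : Type*} [TopologicalSpace α] [T2Space α]
    [MeasurableSpace α] [BorelSpace α] (μ : Measure α) [IsFiniteMeasure μ] [μ.OuterRegular]
    {s : Set α} (hs : AnalyticSet s) : NullMeasurableSet s μ := by
  rw [AnalyticSet] at hs
  rcases hs with rfl | ⟨f, hf, rfl⟩
  · exact nullMeasurableSet_empty
  by_cases h0 : μ (Set.range f) = 0
  · exact NullMeasurableSet.of_null h0
  obtain ⟨u, -, hu, hul⟩ := exists_seq_strictMono_tendsto' (pos_iff_ne_zero.2 h0)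
  choose C hCs hCc hCu using fun n => exists_isCompact_subset_range μ hf (hu n).2
  have hm : NullMeasurableSet (⋃ n, C n) μ :=
    (MeasurableSet.iUnion fun n => (hCc n).measurableSet).nullMeasurableSet
  have hle : μ (Set.range f) ≤ μ (⋃ n, C n) :=
    le_of_tendsto' hul fun n => (hCu n).trans (measure_mono (Set.subset_iUnion C n))
  exact hm.congr (ae_eq_of_subset_of_measure_ge (Set.iUnion_subset hCs) hle hm (measure_ne_top _ _))

/-- Projections of measurable sets along standard Borel spaces are universally measurable. -/
theorem nullMeasurableSet_image_fst {α β : Type*} [MeasurableSpace α] [StandardBorelSpace α]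
    [MeasurableSpace β] [StandardBorelSpace β] (μ : Measure α) [IsFiniteMeasure μ]
    {s : Set (α × β)} (hs : MeasurableSet s) : NullMeasurableSet (Prod.fst '' s) μ := by
  let := upgradeStandardBorel α
  exact nullMeasurableSet_of_analyticSet μ (hs.analyticSet_image measurable_fst)

end Analytic

/-! ### Kolmogorov's zero-one law for universally measurable sets. -/

section Tail

variable {ι X : Type*}

/-- Replace the coordinates outside `T` by the constant `c`. -/
noncomputable def fillOutside (T : Set ι) (c : X) (x : ι → X) : ι → X :=
  open Classical in fun i => if i ∈ T then x i else c

/-- The set `E` is determined by the coordinates in `T`. -/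
def DependsOnCoords (T : Set ι) (E : Set (ι → X)) : Prop :=
  ∀ x y : ι → X, (∀ i ∈ T, x i = y i) → (x ∈ E ↔ y ∈ E)

theorem DependsOnCoords.preimage_fillOutside {T : Set ι} {E : Set (ι → X)}
    (h : DependsOnCoords T E) (c : X) : fillOutside T c ⁻¹' E = E := by
  ext x
  exact h _ _ fun i hi => by simp [fillOutside, hi]

variable [MeasurableSpace X]

/-- The σ-algebra generated by the coordinates in `T`. -/
abbrev coordSigma (ι X : Type*) [MeasurableSpace X] (T : Set ι) : MeasurableSpace (ι → X) :=
  ⨆ i ∈ T, MeasurableSpace.comap (fun x : ι → X => x i) inferInstance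

theorem measurable_fillOutside (T : Set ι) (c : X) :
    Measurable[coordSigma ι X T] (fillOutside (ι := ι) T c) := by
  refine @measurable_pi_lambda _ _ _ (coordSigma ι X T) _ _ fun i => ?_
  by_cases hi : i ∈ T
  · have : (fun x : ι → X => fillOutside T c x i) = fun x => x i := by
      ext x; simp [fillOutside, hi]
    rw [this]
    exact (comap_measurable _).mono (le_iSup₂_of_le i hi le_rfl) le_rfl
  · have : (fun x : ι → X => fillOutside T c x i) = fun _ => c := by
      ext x; simp [fillOutside, hi]
    rw [this]
    exact measurable_const

theorem coordSigma_le (T : Set ι) : coordSigma ι X T ≤ MeasurableSpace.pi :=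
  iSup₂_le fun i _ => (measurable_pi_apply i).comap_le

theorem coordSigma_mono {S T : Set ι} (h : S ⊆ T) : coordSigma ι X S ≤ coordSigma ι X T :=
  biSup_mono h

theorem DependsOnCoords.measurableSet [Nonempty X] {T : Set ι} {E : Set (ι → X)}
    (h : DependsOnCoords T E) (hE : MeasurableSet E) : MeasurableSet[coordSigma ι X T] E := by
  obtain ⟨c⟩ := ‹Nonempty X›
  rw [← h.preimage_fillOutside c]
  exact measurable_fillOutside T c hE

theorem iIndep_coords (μ : ι → Measure X) [∀ i, IsProbabilityMeasure (μ i)] :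
    iIndep (fun i => MeasurableSpace.comap (fun x : ι → X => x i) inferInstance)
      (Measure.infinitePi μ) :=
  iIndepFun_infinitePi (P := μ) (X := fun _ x => x) fun _ => measurable_id

theorem measure_inter_of_dependsOnCoords (μ : ι → Measure X) [∀ i, IsProbabilityMeasure (μ i)]
    {S T : Set ι} (hST : Disjoint S T) {E F : Set (ι → X)} (hE : MeasurableSet E)
    (hF : MeasurableSet F) (hES : DependsOnCoords S E) (hFT : DependsOnCoords T F) :
    Measure.infinitePi μ (E ∩ F) = Measure.infinitePi μ E * Measure.infinitePi μ F := by
  have : Nonempty (ι → X) := (Measure.infinitePi μ).nonempty_of_neZero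
  rcases isEmpty_or_nonempty X with hX | hX
  · have hι : IsEmpty ι := ⟨fun i => hX.elim (Classical.arbitrary (ι → X) i)⟩
    rcases Set.eq_empty_or_nonempty E with rfl | ⟨x, hx⟩
    · simp
    · have : E = Set.univ := by
        ext y; simp [Subsingleton.elim y x, hx]
      simp [this]
  · refine (Indep_iff _ _ _).1 (indep_iSup_of_disjoint
      (fun i => (measurable_pi_apply i).comap_le) (iIndep_coords μ) hST) E F ?_ ?_
    · exact hES.measurableSet hE
    · exact hFT.measurableSet hF

/-- Kolmogorov's zero-one law for universally measurable sets: `lev` assigns levels to the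
coordinates and, for every `m`, the set is determined by the coordinates at levels at least `m`. -/
theorem measure_zero_or_one_of_tail (μ : ι → Measure X) [∀ i, IsProbabilityMeasure (μ i)]
    (lev : ι → ℤ) {E : Set (ι → X)} [Nonempty X]
    (hE : ∀ ν : Measure (ι → X), IsFiniteMeasure ν → NullMeasurableSet E ν)
    (htail : ∀ m : ℤ, DependsOnCoords {i | m ≤ lev i} E) :
    Measure.infinitePi μ E = 0 ∨ Measure.infinitePi μ E = 1 := by
  set P := Measure.infinitePi μ
  obtain ⟨c⟩ := ‹Nonempty X›
  have approx : ∀ m : ℕ, ∃ F, MeasurableSet[coordSigma ι X {i | (m : ℤ) ≤ lev i}] F ∧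
      F =ᵐ[P] E := by
    intro m
    set T : Set ι := {i | (m : ℤ) ≤ lev i}
    have hg : Measurable (fillOutside (ι := ι) T c) :=
      (measurable_fillOutside T c).mono (coordSigma_le T) le_rfl
    -- `E` is approximated under the law of `fillOutside T c` rather than under `P`: pulling back
    -- along `fillOutside` fixes `E` and makes the approximating set measurable for the coordinates
    -- in `T`.
    obtain ⟨F, -, hFm, hFE⟩ :=
      (hE (P.map (fillOutside T c)) inferInstance).exists_measurable_subset_ae_eq
    refine ⟨fillOutside T c ⁻¹' F, measurable_fillOutside T c hFm, ?_⟩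
    have h := ae_eq_comp hg.aemeasurable hFE
    have h2 := (htail m).preimage_fillOutside c
    conv_rhs => rw [← h2]
    exact h
  choose F hFm hFE using approx
  -- The upper limit of the approximations ignores any finite number of them, so `G` is an exact
  -- tail set, although `E` is one only up to null sets.
  let G : Set (ι → X) := ⋂ n : ℕ, ⋃ k : ℕ, F (n + k)
  have hGE : G =ᵐ[P] E := by
    have h : ∀ᵐ x ∂P, ∀ n, (x ∈ F n ↔ x ∈ E) := by
      rw [ae_all_iff]
      exact fun n => (hFE n).mem_iff
    filter_upwards [h] with x hx
    apply propext
    change x ∈ G ↔ x ∈ E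
    simp [G, hx]
  have hGm : ∀ m : ℕ, MeasurableSet[coordSigma ι X {i | (m : ℤ) ≤ lev i}] G := by
    intro m
    have : G = ⋂ n : ℕ, ⋃ k : ℕ, F (m + n + k) := by
      ext x
      simp only [G, Set.mem_iInter, Set.mem_iUnion]
      refine ⟨fun h n => h (m + n), fun h n => ?_⟩
      obtain ⟨k, hk⟩ := h n
      exact ⟨m + k, by rwa [show n + (m + k) = m + n + k by omega]⟩
    rw [this]
    refine MeasurableSet.iInter fun n => MeasurableSet.iUnion fun k => ?_
    refine coordSigma_mono (fun i hi => ?_) _ (hFm (m + n + k))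
    simp only [Set.mem_ofPred_eq] at hi ⊢
    push_cast at hi
    omega
  rw [← measure_congr hGE]
  refine measure_zero_or_one_of_measurableSet_limsup
    (s := fun i => MeasurableSpace.comap (fun x : ι → X => x i) inferInstance)
    (f := comap lev atTop) (p := fun t => ∃ m : ℕ, ∀ i ∈ t, lev i < m)
    (ns := fun m : ℕ => {i | lev i < m})
    (fun i => (measurable_pi_apply i).comap_le) (iIndep_coords μ) ?_ ?_ ?_ ?_ ?_
  · rintro t ⟨m, hm⟩
    refine ⟨Set.Ici (m : ℤ), Ici_mem_atTop _, fun i hi hit => ?_⟩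
    exact absurd (hm i hit) (not_lt.2 hi)
  · intro a b
    refine ⟨max a b, fun i hi => ?_, fun i hi => ?_⟩ <;>
      · simp only [Set.mem_ofPred_eq] at hi ⊢
        push_cast
        omega
  · exact fun m => ⟨m, fun i hi => hi⟩
  · exact fun i => ⟨(lev i).toNat + 1, by simp only [Set.mem_ofPred_eq]; omega⟩
  · rw [limsup_eq_iInf_iSup, MeasurableSpace.measurableSet_iInf]
    intro t
    rw [MeasurableSpace.measurableSet_iInf]
    rintro ⟨u, hu, hut⟩
    obtain ⟨a, ha⟩ := mem_atTop_sets.1 hu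
    refine coordSigma_mono (fun i hi => hut (ha _ ?_)) _ (hGm a.toNat)
    simp only [Set.mem_ofPred_eq] at hi
    omega

end Tail

/-! ### The lazy walk crosses square-root curves. -/

section LazyWalk

/-- One-step averaging operator of the lazy simple random walk on `ℤ`. -/
noncomputable def lazy (f : ℤ → ℝ) (u : ℤ) : ℝ := (f (u + 1) + f (u - 1) + 2 * f u) / 4

theorem lazy_iterate_mono_on (m : ℕ) {f g : ℤ → ℝ} {u : ℤ}
    (h : ∀ x : ℤ, |x - u| ≤ m → f x ≤ g x) : lazy^[m] f u ≤ lazy^[m] g u := by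
  induction m generalizing u with
  | zero => exact h u (by simp)
  | succ m ih =>
    rw [Function.iterate_succ_apply', Function.iterate_succ_apply', lazy, lazy]
    have h1 := ih (u := u + 1) fun x hx => h x (by push_cast; grind)
    have h2 := ih (u := u - 1) fun x hx => h x (by push_cast; grind)
    have h3 := ih (u := u) fun x hx => h x (by push_cast; grind)
    linarith

theorem lazy_iterate_mono (m : ℕ) {f g : ℤ → ℝ} (h : ∀ x, f x ≤ g x) (u : ℤ) :
    lazy^[m] f u ≤ lazy^[m] g u :=
  lazy_iterate_mono_on m fun x _ => h x

theorem lazy_iterate_affine (m : ℕ) (c d : ℝ) (f : ℤ → ℝ) (u : ℤ) :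
    lazy^[m] (fun x => c + d * f x) u = c + d * lazy^[m] f u := by
  induction m generalizing u with
  | zero => rfl
  | succ m ih =>
    simp only [Function.iterate_succ_apply', lazy, ih]
    ring

/-- After `n` steps the displacement has vanishing odd moments, second moment `n/2` and fourth
moment `n/2 + 3n(n-1)/4`; expand around `u`. -/
theorem lazy_iterate_quartic (n : ℕ) (v : ℤ) (A B C D E : ℝ) (u : ℤ) :
    lazy^[n] (fun x => A * ((x : ℝ) - v) ^ 4 + B * ((x : ℝ) - v) ^ 3 + C * ((x : ℝ) - v) ^ 2 +
        D * ((x : ℝ) - v) + E) u =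
      A * ((u : ℝ) - v) ^ 4 + B * ((u : ℝ) - v) ^ 3 + (C + 3 * n * A) * ((u : ℝ) - v) ^ 2 +
        (D + 3 / 2 * n * B) * ((u : ℝ) - v) +
        (E + n / 2 * C + A * (n / 2 + 3 * n * (n - 1) / 4)) := by
  induction n generalizing u with
  | zero => simp
  | succ n ih =>
    simp only [Function.iterate_succ_apply', lazy, ih]
    push_cast
    ring

/-- Indicator of the half-line `(-∞, b]`. -/
noncomputable def indLE (b : ℝ) (x : ℤ) : ℝ := if (x : ℝ) ≤ b then 1 else 0

theorem indLE_nonneg (b : ℝ) (x : ℤ) : 0 ≤ indLE b x := by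
  unfold indLE; split_ifs <;> norm_num

/-- A test polynomial that bounds a probability from below by moments alone. It is positive only for
`-3a < y < -a/4`, where it is at most `2a² · 16a²`; the double zero at `a` keeps it nonpositive to
the right. -/
theorem quartic_le_indLE {a : ℝ} (ha : 0 < a) (y : ℝ) :
    -((y + a / 4) * (y + 3 * a) * (y - a) ^ 2) ≤ 32 * a ^ 4 * (if y ≤ -(a / 4) then 1 else 0) := by
  have h2 : 0 ≤ (y - a) ^ 2 := sq_nonneg _
  split_ifs with h
  · rcases le_or_gt y (-3 * a) with h3 | h3
    · have : 0 ≤ (y + a / 4) * (y + 3 * a) :=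
        mul_nonneg_of_nonpos_of_nonpos (by linarith) (by linarith)
      have := mul_nonneg this h2
      have : 0 < a ^ 4 := by positivity
      linarith
    · have h4 : -((y + a / 4) * (y + 3 * a)) ≤ 2 * a ^ 2 := by
        nlinarith [sq_nonneg (y + 13 / 8 * a), sq_nonneg a]
      have h5 : (y - a) ^ 2 ≤ 16 * a ^ 2 := by nlinarith
      have h6 := mul_le_mul h4 h5 h2 (by positivity)
      linarith
  · have : 0 ≤ (y + a / 4) * (y + 3 * a) :=
      mul_nonneg (by linarith) (by linarith)
    have := mul_nonneg this h2
    linarith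

theorem le_lazy_iterate_indLE {a : ℕ} (ha : 0 < a) {b : ℝ} {v : ℤ} (hv : (v : ℝ) ≤ b + a / 4) :
    1 / 40 ≤ lazy^[a ^ 2] (indLE b) v := by
  have ha' : (0 : ℝ) < a := by exact_mod_cast ha
  have h1 : lazy^[a ^ 2] (fun x : ℤ => (-1) * ((x : ℝ) - v) ^ 4 + (-(5 / 4 * a)) * ((x : ℝ) - v) ^ 3
      + (19 / 4 * a ^ 2) * ((x : ℝ) - v) ^ 2 + (-(7 / 4 * a ^ 3)) * ((x : ℝ) - v)
      + (-(3 / 4 * a ^ 4))) v ≤ lazy^[a ^ 2] (fun x => 0 + 32 * (a : ℝ) ^ 4 * indLE b x) v := by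
    refine lazy_iterate_mono _ (fun x => ?_) v
    have h := quartic_le_indLE ha' ((x : ℝ) - v)
    have h' : (if (x : ℝ) - v ≤ -((a : ℝ) / 4) then (1 : ℝ) else 0) ≤ indLE b x := by
      unfold indLE
      split_ifs <;> linarith
    have h'' := mul_le_mul_of_nonneg_left h' (show (0 : ℝ) ≤ 32 * (a : ℝ) ^ 4 by positivity)
    have := h.trans h''
    linarith
  rw [lazy_iterate_quartic, lazy_iterate_affine] at h1
  push_cast at h1
  have h4 : (0 : ℝ) < a ^ 4 := by positivity
  have h2 : (0 : ℝ) < a ^ 2 := by positivity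
  -- The mean of the test polynomial after `a²` steps is at least `7a⁴/8`, and `7/256 > 1/40`.
  have h5 : (7 / 8 : ℝ) * a ^ 4 ≤ 32 * a ^ 4 * lazy^[a ^ 2] (indLE b) v := by
    refine le_trans ?_ (h1.trans (by linarith))
    ring_nf
    nlinarith
  have h6 : (a : ℝ) ^ 4 * (7 / 8) ≤ a ^ 4 * (32 * lazy^[a ^ 2] (indLE b) v) := by linarith
  have := le_of_mul_le_mul_left h6 h4
  linarith

/-- By the Markov property, each of `r` blocks of `a²` steps lowers the walk by `a/4` at a cost of a
factor `1/40`. -/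
theorem le_lazy_iterate_mul_indLE {a : ℕ} (ha : 0 < a) (r : ℕ) (b : ℝ) (v : ℤ) :
    (1 / 40) ^ r * indLE (b + r * (a / 4)) v ≤ lazy^[r * a ^ 2] (indLE b) v := by
  induction r generalizing v with
  | zero => simp
  | succ r ih =>
    rw [show (r + 1) * a ^ 2 = a ^ 2 + r * a ^ 2 by ring, Function.iterate_add_apply]
    refine le_trans ?_ (lazy_iterate_mono _ ih v)
    have h := lazy_iterate_affine (a ^ 2) 0 ((1 / 40) ^ r) (indLE (b + r * (a / 4))) v
    simp only [zero_add] at h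
    rw [h, pow_succ, mul_assoc]
    refine mul_le_mul_of_nonneg_left ?_ (by positivity)
    by_cases hv : (v : ℝ) ≤ b + (r + 1 : ℕ) * (a / 4)
    · have := le_lazy_iterate_indLE ha (b := b + r * (a / 4)) (v := v)
        (by push_cast at hv; linarith)
      rwa [indLE, if_pos hv, mul_one]
    · have : (0 : ℝ) ≤ lazy^[a ^ 2] (indLE (b + r * (a / 4))) v := by
        have h0 := lazy_iterate_mono (a ^ 2) (f := fun x => 0 + 0 * indLE 0 x)
          (g := indLE (b + r * (a / 4))) (fun x => by simpa using indLE_nonneg _ x) v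
        rw [lazy_iterate_affine] at h0
        simpa using h0
      simpa only [indLE, hv, if_false, mul_zero] using this

/-- In time `s²a²` the walk drops by `s²a/4` with probability at least `(1/40)^(s²)`, while the
curve drops only by about `K s a`. The choice `s > 4(K + 1)` beats the curve, and a large `a`
absorbs `R`, `j` and `k`. That `ε` depends on `K` only makes the estimate repeatable. -/
theorem exists_le_lazy_iterate_sqrt (K : ℝ) (hK : 0 ≤ K) :
    ∃ ε : ℝ, 0 < ε ∧ ε < 1 ∧ ∀ j k R : ℕ, ∃ m : ℕ, ∀ v : ℤ, |v| ≤ R →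
      ε ≤ lazy^[m] (indLE (-j - 1 - K * √((k + m : ℕ) : ℝ))) v := by
  obtain ⟨s, hs⟩ := exists_nat_gt (4 * (K + 1))
  have hs0 : 0 < s := by
    have : (0 : ℝ) < s := by linarith
    exact_mod_cast this
  refine ⟨(1 / 40) ^ (s ^ 2), by positivity, pow_lt_one₀ (by norm_num) (by norm_num)
    (by positivity), fun j k R => ?_⟩
  obtain ⟨a, ha⟩ := exists_nat_gt (R + j + 1 + K * √(k : ℝ))
  have ha0 : 0 < a := by
    have : (0 : ℝ) < a := lt_of_le_of_lt (by positivity) ha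
    exact_mod_cast this
  refine ⟨s ^ 2 * a ^ 2, fun v hv => ?_⟩
  refine le_trans ?_ (le_lazy_iterate_mul_indLE ha0 (s ^ 2) _ v)
  have hvR : (v : ℝ) ≤ R := by exact_mod_cast (le_abs_self v).trans hv
  have hsqrt : √((k + s ^ 2 * a ^ 2 : ℕ) : ℝ) ≤ √(k : ℝ) + s * a := by
    rw [Real.sqrt_le_left (by positivity)]
    push_cast
    have h0 := Real.sq_sqrt (Nat.cast_nonneg (α := ℝ) k)
    have h1 : 0 ≤ √(k : ℝ) * (s * a) := by positivity
    nlinarith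
  have hone : indLE (-j - 1 - K * √((k + s ^ 2 * a ^ 2 : ℕ) : ℝ) + (s ^ 2 : ℕ) * (a / 4)) v = 1 := by
    rw [indLE, if_pos]
    have h1 := mul_le_mul_of_nonneg_left hsqrt hK
    have h2 : (s : ℝ) * a * (4 * (K + 1)) ≤ s * a * s := by
      exact mul_le_mul_of_nonneg_left hs.le (by positivity)
    have h3 : (1 : ℝ) ≤ s := by exact_mod_cast hs0
    have h4 : (a : ℝ) ≤ s * a := by nlinarith [show (0:ℝ) ≤ a by positivity]
    have h5 : (s : ℝ) ^ 2 * (a / 4) ≥ s * a * (K + 1) := by nlinarith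
    push_cast
    push_cast at h1
    nlinarith
  rw [hone, mul_one]

/-- The probability that the lazy walk started from `u` at time `k` satisfies `G` at each of the
times `k, …, k + m - 1`. -/
noncomputable def stayProb (G : ℕ → ℤ → Prop) : ℕ → ℕ → ℤ → ℝ
  | 0 => fun _ _ => 1
  | m + 1 => fun k u => open Classical in if G k u then lazy (stayProb G m (k + 1)) u else 0

open Classical in
theorem stayProb_succ (G : ℕ → ℤ → Prop) (m k : ℕ) (u : ℤ) :
    stayProb G (m + 1) k u = if G k u then lazy (stayProb G m (k + 1)) u else 0 := rfl

theorem stayProb_nonneg (G : ℕ → ℤ → Prop) (m k : ℕ) (u : ℤ) : 0 ≤ stayProb G m k u := by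
  induction m generalizing k u with
  | zero => simp [stayProb]
  | succ m ih =>
    simp only [stayProb]
    split_ifs
    · have h1 := ih (k + 1) (u + 1)
      have h2 := ih (k + 1) (u - 1)
      have h3 := ih (k + 1) u
      unfold lazy; linarith
    · exact le_rfl

theorem stayProb_succ_le (G : ℕ → ℤ → Prop) (m k : ℕ) (u : ℤ) :
    stayProb G (m + 1) k u ≤ lazy (stayProb G m (k + 1)) u := by
  simp only [stayProb]
  split_ifs
  · exact le_rfl
  · have h1 := stayProb_nonneg G m (k + 1) (u + 1)
    have h2 := stayProb_nonneg G m (k + 1) (u - 1)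
    have h3 := stayProb_nonneg G m (k + 1) u
    unfold lazy; linarith

theorem stayProb_antitone_succ (G : ℕ → ℤ → Prop) (m k : ℕ) (u : ℤ) :
    stayProb G (m + 1) k u ≤ stayProb G m k u := by
  induction m generalizing k u with
  | zero =>
    refine (stayProb_succ_le G 0 k u).trans ?_
    simp [stayProb, lazy]; norm_num
  | succ m ih =>
    rw [stayProb_succ, stayProb_succ G m]
    split_ifs
    · exact lazy_iterate_mono 1 (ih (k + 1)) u
    · exact le_rfl

theorem stayProb_add_le (G : ℕ → ℤ → Prop) (m m' k : ℕ) (u : ℤ) :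
    stayProb G (m + m') k u ≤ lazy^[m] (stayProb G m' (k + m)) u := by
  induction m generalizing k u with
  | zero => simp
  | succ m ih =>
    rw [show m + 1 + m' = m + m' + 1 by ring, Function.iterate_succ_apply']
    refine (stayProb_succ_le G _ k u).trans ?_
    rw [show k + (m + 1) = k + 1 + m by ring]
    exact lazy_iterate_mono 1 (ih (k + 1)) u

/-- Each round kills a proportion `ε` of the walks, uniformly over starting points in a bounded
range; a round of `m` steps enlarges the range from `R` to `R + m`, which the next round allows for.
-/
theorem exists_stayProb_le_pow (K : ℝ) (hK : 0 ≤ K) : ∃ ε : ℝ, 0 < ε ∧ ε < 1 ∧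
    ∀ j i k R : ℕ, ∃ m : ℕ, ∀ u : ℤ, |u| ≤ R →
      stayProb (fun k u => -(j : ℝ) - K * √(k : ℝ) ≤ (u : ℝ)) m k u ≤ (1 - ε) ^ i := by
  obtain ⟨ε, hε, hε1, H⟩ := exists_le_lazy_iterate_sqrt K hK
  refine ⟨ε, hε, hε1, fun j i => ?_⟩
  set G : ℕ → ℤ → Prop := fun k u => -(j : ℝ) - K * √(k : ℝ) ≤ (u : ℝ)
  induction i with
  | zero => exact fun k R => ⟨0, fun u _ => by simp [stayProb]⟩
  | succ i ih =>
    intro k R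
    obtain ⟨m, hm⟩ := H j k R
    obtain ⟨m', hm'⟩ := ih (k + m) (R + m)
    refine ⟨m + (m' + 1), fun u hu => (stayProb_add_le G m (m' + 1) k u).trans ?_⟩
    -- The `-1` puts `b` strictly below the curve, so a walk at or below `b` violates `G (k + m)`.
    -- The extra step in `m' + 1` ensures that this condition is tested even if `m' = 0`.
    set b : ℝ := -j - 1 - K * √((k + m : ℕ) : ℝ)
    have hpow : (0 : ℝ) ≤ (1 - ε) ^ i := pow_nonneg (by linarith) _
    have h1 : lazy^[m] (stayProb G (m' + 1) (k + m)) u ≤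
        lazy^[m] (fun x => (1 - ε) ^ i + (-(1 - ε) ^ i) * indLE b x) u := by
      refine lazy_iterate_mono_on m fun x hx => ?_
      by_cases hb : (x : ℝ) ≤ b
      · have : ¬ G (k + m) x := by
          simp only [G, not_le]
          refine lt_of_le_of_lt hb ?_
          simp only [b]
          linarith
        simp [stayProb, this, indLE, hb]
      · have h2 := (stayProb_antitone_succ G m' (k + m) x).trans
          (hm' x (by push_cast; grind))
        simpa [indLE, hb] using h2
    refine h1.trans ?_
    rw [lazy_iterate_affine, pow_succ]
    have := mul_le_mul_of_nonneg_left (hm u hu) hpow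
    linarith

/-- The lazy walk does not stay above a square root curve. -/
theorem exists_stayProb_lower_le (K : ℝ) (hK : 0 ≤ K) (j k : ℕ) (u : ℤ) {η : ℝ} (hη : 0 < η) :
    ∃ m, stayProb (fun k u => -(j : ℝ) - K * √(k : ℝ) ≤ (u : ℝ)) m k u ≤ η := by
  obtain ⟨ε, hε, hε1, H⟩ := exists_stayProb_le_pow K hK
  obtain ⟨i, hi⟩ := exists_pow_lt_of_lt_one hη (show 1 - ε < 1 by linarith)
  obtain ⟨m, hm⟩ := H j i k u.natAbs
  exact ⟨m, (hm u (by simp)).trans hi.le⟩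

theorem stayProb_neg (G : ℕ → ℤ → Prop) (m k : ℕ) (u : ℤ) :
    stayProb (fun k u => G k (-u)) m k u = stayProb G m k (-u) := by
  induction m generalizing k u with
  | zero => rfl
  | succ m ih =>
    simp only [stayProb, lazy, ih]
    rw [show -(u + 1) = -u - 1 by ring, show -(u - 1) = -u + 1 by ring,
      add_comm (stayProb G m (k + 1) (-u - 1))]

/-- The lazy walk does not stay below a square root curve. -/
theorem exists_stayProb_upper_le (K : ℝ) (hK : 0 ≤ K) (j k : ℕ) (u : ℤ) {η : ℝ} (hη : 0 < η) :
    ∃ m, stayProb (fun k u => (u : ℝ) ≤ j + K * √(k : ℝ)) m k u ≤ η := by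
  obtain ⟨m, hm⟩ := exists_stayProb_lower_le K hK j k (-u) hη
  refine ⟨m, ?_⟩
  rw [← stayProb_neg] at hm
  have : (fun (k : ℕ) (u : ℤ) => (u : ℝ) ≤ j + K * √(k : ℝ)) =
      fun (k : ℕ) (u : ℤ) => -(j : ℝ) - K * √(k : ℝ) ≤ ((-u : ℤ) : ℝ) := by
    ext k u
    push_cast
    constructor <;> intro h <;> linarith
  rwa [this]

end LazyWalk

/-! ### Sites, arrows and coalescence. -/

section Sites

/-- The site reached from `z` along an arrow `s`. -/
def move (z : Site) (s : ℤˣ) : Site := step (fun _ => s) z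

@[simp] theorem move_fst (z : Site) (s : ℤˣ) : (move z s).1.1 = z.1.1 + (s : ℤ) := rfl

@[simp] theorem move_snd (z : Site) (s : ℤˣ) : (move z s).1.2 = z.1.2 + 1 := rfl

theorem step_eq_move (ξ : Arrows) (z : Site) : step ξ z = move z (ξ z) := rfl

theorem site_ext {z w : Site} (h1 : z.1.1 = w.1.1) (h2 : z.1.2 = w.1.2) : z = w :=
  Subtype.ext (Prod.ext h1 h2)

theorem site_parity (z : Site) : (z.1.1 + z.1.2) % 2 = 0 := Int.even_iff.1 z.2

theorem siteAfter_succ (ξ : Arrows) (z : Site) (n : ℕ) :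
    siteAfter ξ z (n + 1) = siteAfter ξ (step ξ z) n := Function.iterate_succ_apply _ _ _

theorem siteAfter_succ' (ξ : Arrows) (z : Site) (n : ℕ) :
    siteAfter ξ z (n + 1) = step ξ (siteAfter ξ z n) := Function.iterate_succ_apply' _ _ _

@[simp] theorem siteAfter_snd (ξ : Arrows) (z : Site) (n : ℕ) :
    (siteAfter ξ z n).1.2 = z.1.2 + n := by
  induction n with
  | zero => simp [siteAfter]
  | succ n ih => rw [siteAfter_succ', step_eq_move, move_snd, ih]; push_cast; ring

/-- The paths from `z` and `w` are at the same site after the same number of steps. -/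
def Coalesce (ξ : Arrows) (z w : Site) : Prop := ∃ n, siteAfter ξ z n = siteAfter ξ w n

theorem not_coalesce_step {ξ : Arrows} {z w : Site} (h : ¬ Coalesce ξ z w) :
    ¬ Coalesce ξ (step ξ z) (step ξ w) := by
  rintro ⟨n, hn⟩
  exact h ⟨n + 1, by rwa [siteAfter_succ, siteAfter_succ]⟩

theorem ne_of_not_coalesce {ξ : Arrows} {z w : Site} (h : ¬ Coalesce ξ z w) : z ≠ w :=
  fun e => h ⟨0, e⟩

end Sites

/-! ### Extremal paths over a window of dynamical times. -/

section Environment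

instance : MeasurableSingletonClass ℤˣ :=
  ⟨fun u => ⟨{(u : ℤ)}, measurableSet_singleton _, by ext v; simp [Units.ext_iff]⟩⟩

/-- An environment records at each site whether the clock rings and the initial arrow. -/
abbrev Env : Type := Site → Bool × ℤˣ

/-- The leftmost arrow available at a site in a state. -/
def lo (a : Bool × ℤˣ) : ℤˣ := if a.1 then -1 else a.2

/-- The rightmost arrow available at a site in a state. -/
def hi (a : Bool × ℤˣ) : ℤˣ := if a.1 then 1 else a.2

/-- The arrow configuration `ξ` agrees with the initial arrows where no clock rings. -/
def Compatible (ξ : Arrows) (η : Env) : Prop := ∀ z, (η z).1 = false → ξ z = (η z).2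

theorem Compatible.lo_le {ξ : Arrows} {η : Env} (h : Compatible ξ η) (z : Site) :
    ((lo (η z) : ℤˣ) : ℤ) ≤ (ξ z : ℤ) := by
  unfold lo
  split_ifs with h1
  · rcases Int.units_eq_one_or (ξ z) with h2 | h2 <;> simp [h2]
  · rw [h z (by simpa using h1)]

theorem Compatible.le_hi {ξ : Arrows} {η : Env} (h : Compatible ξ η) (z : Site) :
    (ξ z : ℤ) ≤ ((hi (η z) : ℤˣ) : ℤ) := by
  unfold hi
  split_ifs with h1
  · rcases Int.units_eq_one_or (ξ z) with h2 | h2 <;> simp [h2]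
  · rw [h z (by simpa using h1)]

/-- The leftmost path from `z` stays strictly to the left of the rightmost path from `w` during
`n` steps. -/
def Surv (η : Env) : ℕ → Site → Site → Prop
  | 0, z, w => z.1.1 < w.1.1
  | n + 1, z, w => z.1.1 < w.1.1 ∧ Surv η n (move z (lo (η z))) (move w (hi (η w)))

/-- The pair follows the common initial arrows for `m` steps, with midpoints in `G`, until a clock
rings at one of its sites; from then on its extremal paths stay apart forever. -/
def Mixed (G : ℕ → ℤ → Prop) (η : Env) : ℕ → ℕ → Site → Site → Prop
  | 0, _, z, w => ∀ n, Surv η n z w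
  | m + 1, k, z, w => z.1.1 < w.1.1 ∧ G k ((z.1.1 + w.1.1) / 2) ∧
      if (η z).1 ∨ (η w).1 then ∀ n, Surv η n (move z (lo (η z))) (move w (hi (η w)))
      else Mixed G η m (k + 1) (move z (lo (η z))) (move w (hi (η w)))

theorem unit_abs_le (s : ℤˣ) : (s : ℤ) = 1 ∨ (s : ℤ) = -1 := by
  rcases Int.units_eq_one_or s with h | h <;> simp [h]

/-- Paths that start between the extremal ones stay between them: by parity, ordered paths on the
same level cannot cross without meeting, and where they meet `lo` and `hi` are the extreme choices.
The inner sites `y`, `x` are separate from `z`, `w` so that the induction runs. -/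
theorem surv_of_not_coalesce {ξ : Arrows} {η : Env} (h : Compatible ξ η) (n : ℕ)
    {z w y x : Site} (hy : y.1.2 = z.1.2) (hx : x.1.2 = z.1.2) (hw : w.1.2 = z.1.2)
    (h1 : z.1.1 ≤ y.1.1) (h2 : y.1.1 < x.1.1) (h3 : x.1.1 ≤ w.1.1) (hc : ¬ Coalesce ξ y x) :
    Surv η n z w := by
  induction n generalizing z w y x with
  | zero => show z.1.1 < w.1.1; omega
  | succ n ih =>
    refine ⟨by omega, ?_⟩
    have hc' := not_coalesce_step hc
    have hne := ne_of_not_coalesce hc'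
    have pz := site_parity z
    have pw := site_parity w
    have px := site_parity x
    have py := site_parity y
    rw [step_eq_move, step_eq_move] at hc' hne
    have ux := unit_abs_le (ξ x)
    have uy := unit_abs_le (ξ y)
    refine ih (y := move y (ξ y)) (x := move x (ξ x)) ?_ ?_ ?_ ?_ ?_ ?_ hc'
    · simp [hy]
    · simp [hx]
    · simp [hw]
    · have ul := unit_abs_le (lo (η z))
      have e : z = y → ((lo (η z) : ℤˣ) : ℤ) ≤ (ξ y : ℤ) := by rintro rfl; exact h.lo_le _
      have e' : z.1.1 = y.1.1 → z = y := fun e => site_ext e hy.symm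
      simp only [move_fst]
      by_cases hzy : z.1.1 = y.1.1
      · have := e (e' hzy); omega
      · omega
    · have : (move y (ξ y)).1.1 ≠ (move x (ξ x)).1.1 := fun e =>
        hne (site_ext e (by simp [hy, hx]))
      simp only [move_fst] at this ⊢
      omega
    · have ul := unit_abs_le (hi (η w))
      have e : x = w → (ξ x : ℤ) ≤ ((hi (η w) : ℤˣ) : ℤ) := by rintro rfl; exact h.le_hi _
      have e' : x.1.1 = w.1.1 → x = w := fun e => site_ext e (hx.trans hw.symm)
      simp only [move_fst]
      by_cases hzy : x.1.1 = w.1.1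
      · have := e (e' hzy); omega
      · omega

/-- Until a clock rings at one of the two sites, the extremal arrows are the actual ones, so `G` is
tested on the true midpoints; after the ring only the sandwich by extremal paths is kept. -/
theorem mixed_of_not_coalesce {ξ : Arrows} {η : Env} (h : Compatible ξ η) (G : ℕ → ℤ → Prop)
    (m k : ℕ) {z w : Site} (hw : w.1.2 = z.1.2) (h1 : z.1.1 < w.1.1) (hc : ¬ Coalesce ξ z w)
    (hG : ∀ n, G (k + n) (((siteAfter ξ z n).1.1 + (siteAfter ξ w n).1.1) / 2)) :
    Mixed G η m k z w := by
  induction m generalizing k z w with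
  | zero => exact fun n => surv_of_not_coalesce h n rfl hw hw le_rfl h1 le_rfl hc
  | succ m ih =>
    refine ⟨h1, hG 0, ?_⟩
    have pz := site_parity z
    have pw := site_parity w
    split_ifs with hr
    · intro n
      have := surv_of_not_coalesce h (n + 1) rfl hw hw le_rfl h1 le_rfl hc
      exact this.2
    · push Not at hr
      have ez : lo (η z) = ξ z := by
        have := h z (by simpa using hr.1)
        simp [lo, hr.1, this]
      have ew : hi (η w) = ξ w := by
        have := h w (by simpa using hr.2)
        simp [hi, hr.2, this]
      rw [ez, ew]
      have hc' := not_coalesce_step hc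
      have hne := ne_of_not_coalesce hc'
      have uz := unit_abs_le (ξ z)
      have uw := unit_abs_le (ξ w)
      refine ih (k + 1) (by simp [hw]) ?_ hc' fun n => ?_
      · have : (step ξ z).1.1 ≠ (step ξ w).1.1 := fun e =>
          hne (site_ext e (by simp [step_eq_move, hw]))
        rw [step_eq_move, step_eq_move] at this
        simp only [move_fst] at this ⊢
        omega
      · have := hG (n + 1)
        rw [siteAfter_succ, siteAfter_succ] at this
        rwa [show k + 1 + n = k + (n + 1) by ring]

/-- The set of environments whose states at `z` and `w` select, through `F`, a set containing
the environment. -/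
def splitSet (z w : Site) (F : Bool × ℤˣ → Bool × ℤˣ → Set Env) : Set Env :=
  {η | η ∈ F (η z) (η w)}

theorem splitSet_eq_iUnion (z w : Site) (F : Bool × ℤˣ → Bool × ℤˣ → Set Env) :
    splitSet z w F = ⋃ ab ∈ (Finset.univ : Finset ((Bool × ℤˣ) × (Bool × ℤˣ))),
      ({η : Env | η z = ab.1 ∧ η w = ab.2} ∩ F ab.1 ab.2) := by
  ext η
  simp only [splitSet, Set.mem_ofPred_eq, Finset.mem_univ, Set.iUnion_true, Set.mem_iUnion,
    Set.mem_inter_iff]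
  constructor
  · exact fun h => ⟨(η z, η w), ⟨rfl, rfl⟩, h⟩
  · rintro ⟨⟨a, b⟩, ⟨rfl, rfl⟩, h⟩
    exact h

theorem measurableSet_states (z w : Site) (a b : Bool × ℤˣ) :
    MeasurableSet {η : Env | η z = a ∧ η w = b} := by
  have h1 : MeasurableSet ((fun η : Env => η z) ⁻¹' {a}) :=
    measurable_pi_apply z (measurableSet_singleton a)
  have h2 : MeasurableSet ((fun η : Env => η w) ⁻¹' {b}) :=
    measurable_pi_apply w (measurableSet_singleton b)
  exact h1.inter h2

theorem measurableSet_splitSet (z w : Site) {F : Bool × ℤˣ → Bool × ℤˣ → Set Env}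
    (hF : ∀ a b, MeasurableSet (F a b)) : MeasurableSet (splitSet z w F) := by
  rw [splitSet_eq_iUnion]
  exact Finset.measurableSet_biUnion _ fun ab _ => (measurableSet_states _ _ _ _).inter (hF _ _)

theorem dependsOnCoords_splitSet {z w : Site} (hw : w.1.2 = z.1.2)
    {F : Bool × ℤˣ → Bool × ℤˣ → Set Env}
    (hF : ∀ a b, DependsOnCoords {x : Site | z.1.2 + 1 ≤ x.1.2} (F a b)) :
    DependsOnCoords {x : Site | z.1.2 ≤ x.1.2} (splitSet z w F) := by
  intro x y hxy
  have h1 : x z = y z := hxy z (by simp)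
  have h2 : x w = y w := hxy w (by simp [hw])
  simp only [splitSet, Set.mem_ofPred_eq, h1, h2]
  refine hF _ _ x y fun i hi => hxy i ?_
  simp only [Set.mem_ofPred_eq] at hi ⊢
  omega

variable (ρ : Measure (Bool × ℤˣ)) [IsProbabilityMeasure ρ]

/-- One-step Markov property: the states at `z` and `w` are independent of each other and of all
later levels. -/
theorem measureReal_splitSet {z w : Site} (hw : w.1.2 = z.1.2) (hzw : z ≠ w)
    {F : Bool × ℤˣ → Bool × ℤˣ → Set Env} (hFm : ∀ a b, MeasurableSet (F a b))
    (hF : ∀ a b, DependsOnCoords {x : Site | z.1.2 + 1 ≤ x.1.2} (F a b)) :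
    (Measure.infinitePi fun _ : Site => ρ).real (splitSet z w F) =
      ∑ a, ∑ b, ρ.real {a} * ρ.real {b} * (Measure.infinitePi fun _ : Site => ρ).real (F a b) := by
  classical
  rw [splitSet_eq_iUnion, measureReal_biUnion_finset, ← Finset.univ_product_univ,
    Finset.sum_product]
  · refine Finset.sum_congr rfl fun a _ => Finset.sum_congr rfl fun b _ => ?_
    have hind := measure_inter_of_dependsOnCoords (fun _ : Site => ρ)
      (S := {z, w}) (T := {x : Site | z.1.2 + 1 ≤ x.1.2}) ?_ (measurableSet_states z w a b)
      (hFm a b) ?_ (hF a b)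
    · have hbox : {η : Env | η z = a ∧ η w = b} =
          Set.pi (({z, w} : Finset Site) : Set Site) (fun x => if x = z then {a} else {b}) := by
        ext η
        simp [Set.pi, hzw.symm]
      simp only [measureReal_def]
      rw [hind, hbox, Measure.infinitePi_pi]
      · rw [Finset.prod_pair hzw]
        simp [hzw.symm, ENNReal.toReal_mul]
      · intro i _
        exact MeasurableSet.of_discrete
    · rw [Set.disjoint_left]
      rintro x hx hx'
      simp only [Set.mem_ofPred_eq] at hx'
      rcases hx with rfl | rfl <;> omega
    · intro x y hxy
      simp [hxy z (by simp), hxy w (by simp)]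
  · rintro ⟨a, b⟩ - ⟨a', b'⟩ - hne
    rw [Function.onFun, Set.disjoint_left]
    rintro η ⟨⟨h1, h2⟩, -⟩ ⟨⟨h3, h4⟩, -⟩
    exact hne (by simp_all)
  · exact fun ab _ => (measurableSet_states _ _ _ _).inter (hFm _ _)

theorem surv_succ_eq {n : ℕ} {z w : Site} (h : z.1.1 < w.1.1) :
    {η | Surv η (n + 1) z w} =
      splitSet z w fun a b => {η | Surv η n (move z (lo a)) (move w (hi b))} := by
  ext η
  simp [Surv, splitSet, h]

theorem surv_empty {n : ℕ} {z w : Site} (h : ¬ z.1.1 < w.1.1) : {η | Surv η n z w} = ∅ := by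
  ext η
  cases n <;> simp [Surv, h]

theorem measurableSet_surv (n : ℕ) (z w : Site) : MeasurableSet {η | Surv η n z w} := by
  induction n generalizing z w with
  | zero => simp [Surv]
  | succ n ih =>
    by_cases h : z.1.1 < w.1.1
    · rw [surv_succ_eq h]
      exact measurableSet_splitSet z w fun a b => ih _ _
    · rw [surv_empty h]
      exact MeasurableSet.empty

theorem dependsOnCoords_surv (n : ℕ) {z w : Site} (hw : w.1.2 = z.1.2) :
    DependsOnCoords {x : Site | z.1.2 ≤ x.1.2} {η | Surv η n z w} := by
  induction n generalizing z w with
  | zero => intro x y _; simp [Surv]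
  | succ n ih =>
    by_cases h : z.1.1 < w.1.1
    · rw [surv_succ_eq h]
      refine dependsOnCoords_splitSet hw fun a b => ?_
      exact ih (z := move z (lo a)) (w := move w (hi b)) (by simp [hw])
    · rw [surv_empty h]
      intro x y _
      simp

theorem measurableSet_forall_surv (z w : Site) : MeasurableSet {η | ∀ n, Surv η n z w} := by
  simp only [Set.ofPred_forall]
  exact MeasurableSet.iInter fun n => measurableSet_surv n z w

theorem dependsOnCoords_forall_surv {z w : Site} (hw : w.1.2 = z.1.2) :
    DependsOnCoords {x : Site | z.1.2 ≤ x.1.2} {η | ∀ n, Surv η n z w} :=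
  fun x y hxy => forall_congr' fun n => dependsOnCoords_surv n hw x y hxy

theorem mixed_succ_eq {G : ℕ → ℤ → Prop} {m k : ℕ} {z w : Site} (h : z.1.1 < w.1.1)
    (hG : G k ((z.1.1 + w.1.1) / 2)) :
    {η | Mixed G η (m + 1) k z w} = splitSet z w fun a b => if a.1 ∨ b.1 then
        {η | ∀ n, Surv η n (move z (lo a)) (move w (hi b))}
      else {η | Mixed G η m (k + 1) (move z (lo a)) (move w (hi b))} := by
  ext η
  by_cases hr : (η z).1 = true ∨ (η w).1 = true <;> simp [Mixed, splitSet, h, hG, hr]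

theorem mixed_empty {G : ℕ → ℤ → Prop} {m k : ℕ} {z w : Site}
    (h : ¬ (z.1.1 < w.1.1 ∧ G k ((z.1.1 + w.1.1) / 2))) :
    {η | Mixed G η (m + 1) k z w} = ∅ := by
  ext η
  simp only [Mixed, Set.mem_ofPred_eq, Set.mem_empty_iff_false, iff_false]
  exact fun h' => h ⟨h'.1, h'.2.1⟩

theorem measurableSet_mixed (G : ℕ → ℤ → Prop) (m k : ℕ) (z w : Site) :
    MeasurableSet {η | Mixed G η m k z w} := by
  induction m generalizing k z w with
  | zero => exact measurableSet_forall_surv z w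
  | succ m ih =>
    by_cases h : z.1.1 < w.1.1 ∧ G k ((z.1.1 + w.1.1) / 2)
    · rw [mixed_succ_eq h.1 h.2]
      refine measurableSet_splitSet z w fun a b => ?_
      split_ifs
      · exact measurableSet_forall_surv _ _
      · exact ih _ _ _
    · rw [mixed_empty h]
      exact MeasurableSet.empty

theorem dependsOnCoords_mixed (G : ℕ → ℤ → Prop) (m k : ℕ) {z w : Site} (hw : w.1.2 = z.1.2) :
    DependsOnCoords {x : Site | z.1.2 ≤ x.1.2} {η | Mixed G η m k z w} := by
  induction m generalizing k z w with
  | zero => exact dependsOnCoords_forall_surv hw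
  | succ m ih =>
    by_cases h : z.1.1 < w.1.1 ∧ G k ((z.1.1 + w.1.1) / 2)
    · rw [mixed_succ_eq h.1 h.2]
      refine dependsOnCoords_splitSet hw fun a b => ?_
      split_ifs
      · exact dependsOnCoords_forall_surv (z := move z (lo a)) (w := move w (hi b)) (by simp [hw])
      · exact ih (k + 1) (z := move z (lo a)) (w := move w (hi b)) (by simp [hw])
    · rw [mixed_empty h]
      intro x y _
      simp

end Environment

/-! ### Probability that extremal paths stay apart. -/

section Estimate

variable {ρ : Measure (Bool × ℤˣ)} [IsProbabilityMeasure ρ] {p : ℝ}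

theorem sum_states {f : (Bool × ℤˣ) → ℝ} :
    ∑ a, f a = f (true, 1) + f (true, -1) + f (false, 1) + f (false, -1) := by
  rw [Fintype.sum_prod_type]
  simp [UnitsInt.univ]
  ring

/-- The half distance of the extremal paths steps by `+1`, `0`, `-1` with probabilities
`((1+p)/2)²`, `(1-p²)/2`, `((1-p)/2)²`. For this walk `θ^(2d)` is harmonic and `θ^d` is an
eigenfunction with eigenvalue `1 - p²`. So the right-hand side is reproduced exactly by one step; it
is at least 1 for `n = 0` and nonnegative for `d = 0`. -/
theorem measureReal_surv_le (hp0 : 0 ≤ p) (hp1 : p ≤ 1)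
    (hρ : ∀ b s, ρ.real {(b, s)} = (if b then p else 1 - p) / 2) (n d : ℕ) {z w : Site}
    (hw : w.1.2 = z.1.2) (hd : w.1.1 = z.1.1 + 2 * d) :
    (Measure.infinitePi fun _ : Site => ρ).real {η | Surv η n z w} ≤
      1 - ((1 - p) / (1 + p)) ^ (2 * d) + (1 - p ^ 2) ^ n * ((1 - p) / (1 + p)) ^ d := by
  set θ := (1 - p) / (1 + p) with hθ
  have hpp : 0 < 1 + p := by linarith
  have hθ0 : 0 ≤ θ := div_nonneg (by linarith) hpp.le
  have hθ1 : θ ≤ 1 := by rw [hθ, div_le_one hpp]; linarith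
  have hθp : 1 - p = θ * (1 + p) := by rw [hθ]; field_simp
  induction n generalizing d z w with
  | zero =>
    refine measureReal_le_one.trans ?_
    have : θ ^ (2 * d) ≤ θ ^ d := pow_le_pow_of_le_one hθ0 hθ1 (by omega)
    linarith
  | succ n ih =>
    have hq : 0 ≤ 1 - p ^ 2 := by nlinarith
    rcases d with - | e
    · rw [surv_empty (by simp [hd])]
      simp only [measureReal_empty]
      have := pow_nonneg hq (n + 1)
      simpa using this
    · have hlt : z.1.1 < w.1.1 := by rw [hd]; push_cast; omega
      rw [surv_succ_eq hlt, measureReal_splitSet ρ hw (fun h => by simp [h] at hlt)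
        (fun a b => measurableSet_surv _ _ _)
        (fun a b => dependsOnCoords_surv n (z := move z (lo a)) (w := move w (hi b))
          (by simp [hw]))]
      have h11 := ih (e + 1) (z := move z 1) (w := move w 1) (by simp [hw])
        (by simp [hd]; ring)
      have h12 := ih e (z := move z 1) (w := move w (-1)) (by simp [hw])
        (by simp [hd]; ring)
      have h21 := ih (e + 2) (z := move z (-1)) (w := move w 1) (by simp [hw])
        (by simp [hd]; ring)
      have h22 := ih (e + 1) (z := move z (-1)) (w := move w (-1)) (by simp [hw])
        (by simp [hd]; ring)
      simp only [sum_states, hρ, lo, hi, if_true, Bool.false_eq_true, if_false]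
      set A := (Measure.infinitePi fun _ : Site => ρ).real {η | Surv η n (move z 1) (move w 1)}
      set B := (Measure.infinitePi fun _ : Site => ρ).real
        {η | Surv η n (move z 1) (move w (-1))}
      set C := (Measure.infinitePi fun _ : Site => ρ).real
        {η | Surv η n (move z (-1)) (move w 1)}
      set D := (Measure.infinitePi fun _ : Site => ρ).real
        {η | Surv η n (move z (-1)) (move w (-1))}
      have w1 : 0 ≤ ((1 + p) / 2) ^ 2 := by positivity
      have w2 : 0 ≤ (1 - p ^ 2) / 4 := by linarith
      have w3 : 0 ≤ ((1 - p) / 2) ^ 2 := by positivity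
      have key : ((1 + p) / 2) ^ 2 * C + (1 - p ^ 2) / 4 * A + (1 - p ^ 2) / 4 * D +
          ((1 - p) / 2) ^ 2 * B ≤
          1 - θ ^ (2 * (e + 1)) + (1 - p ^ 2) ^ (n + 1) * θ ^ (e + 1) := by
        have k1 := mul_le_mul_of_nonneg_left h21 w1
        have k2 := mul_le_mul_of_nonneg_left h11 w2
        have k3 := mul_le_mul_of_nonneg_left h22 w2
        have k4 := mul_le_mul_of_nonneg_left h12 w3
        refine (add_le_add (add_le_add (add_le_add k1 k2) k3) k4).trans (le_of_eq ?_)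
        have hp2 : (1 + θ) * (1 + p) = 2 := by linarith
        rw [pow_succ (1 - p ^ 2) n]
        generalize (1 - p ^ 2) ^ n = Q at *
        have e1 : θ ^ (2 * (e + 2)) = θ ^ (2 * e) * θ ^ 4 := by ring
        have e2 : θ ^ (2 * (e + 1)) = θ ^ (2 * e) * θ ^ 2 := by ring
        have e3 : θ ^ (e + 2) = θ ^ e * θ ^ 2 := by ring
        have e4 : θ ^ (e + 1) = θ ^ e * θ := by ring
        rw [e1, e2, e3, e4]
        have hθ' : 1 + θ ≠ 0 := by linarith
        have hp : p = (1 - θ) / (1 + θ) := by field_simp; linarith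
        generalize θ ^ (2 * e) = X
        generalize θ ^ e = Y
        rw [hp]
        field_simp
        ring
      refine le_trans (le_of_eq ?_) key
      ring

/-- Extremal paths at distance `2 d` stay apart forever with probability at most `4 d p`. -/
theorem measureReal_forall_surv_le (hp0 : 0 < p) (hp1 : p ≤ 1)
    (hρ : ∀ b s, ρ.real {(b, s)} = (if b then p else 1 - p) / 2) (d : ℕ) {z w : Site}
    (hw : w.1.2 = z.1.2) (hd : w.1.1 = z.1.1 + 2 * d) :
    (Measure.infinitePi fun _ : Site => ρ).real {η | ∀ n, Surv η n z w} ≤ 4 * d * p := by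
  set θ := (1 - p) / (1 + p) with hθ
  have hlim : Tendsto (fun n : ℕ => 1 - θ ^ (2 * d) + (1 - p ^ 2) ^ n * θ ^ d) atTop
      (nhds (1 - θ ^ (2 * d) + 0 * θ ^ d)) := by
    refine tendsto_const_nhds.add (Tendsto.mul_const _ ?_)
    exact tendsto_pow_atTop_nhds_zero_of_lt_one (by nlinarith) (by nlinarith)
  have h1 : (Measure.infinitePi fun _ : Site => ρ).real {η | ∀ n, Surv η n z w} ≤
      1 - θ ^ (2 * d) + 0 * θ ^ d :=
    ge_of_tendsto' hlim fun n =>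
      (measureReal_mono (Set.ofPred_subset_ofPred.2 fun η hη => hη n)).trans (measureReal_surv_le hp0.le hp1 hρ n d hw hd)
  have hpp : 0 < 1 + p := by linarith
  have hθ2 : θ = 1 + -(2 * p / (1 + p)) := by rw [hθ]; field_simp; ring
  have hθ0 : 0 ≤ θ := div_nonneg (by linarith) hpp.le
  have h2 := one_add_mul_le_pow (a := -(2 * p / (1 + p))) (by linarith) (2 * d)
  rw [← hθ2] at h2
  have h3 : 2 * p / (1 + p) ≤ 2 * p := div_le_self (by linarith) (by linarith)
  have h4 := mul_le_mul_of_nonneg_left h3 (show (0 : ℝ) ≤ (2 * d : ℕ) by positivity)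
  push_cast at h2 h4
  linarith

/-- Without rings, either the midpoint moves by one or the half distance does, each of the four
moves having equal weight. Since the half distance is a martingale, `d` factors out and the midpoint
contributes `stayProb` of a lazy walk. A ring costs at most `2p` per step, and then separation costs
at most `4p` times a half distance of at most `d + m`; this gives the second term. -/
theorem measureReal_mixed_le (hp0 : 0 < p) (hp1 : p ≤ 1)
    (hρ : ∀ b s, ρ.real {(b, s)} = (if b then p else 1 - p) / 2) (G : ℕ → ℤ → Prop)
    (m k d : ℕ) {z w : Site} (hw : w.1.2 = z.1.2) (hd : w.1.1 = z.1.1 + 2 * d) :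
    (Measure.infinitePi fun _ : Site => ρ).real {η | Mixed G η m k z w} ≤
      4 * p * (d * stayProb G m k (z.1.1 + d) + 2 * p * m * (d + m)) := by
  induction m generalizing k d z w with
  | zero =>
    refine (measureReal_forall_surv_le hp0 hp1 hρ d hw hd).trans (le_of_eq ?_)
    simp [stayProb]
    ring
  | succ m ih =>
    by_cases h : z.1.1 < w.1.1 ∧ G k ((z.1.1 + w.1.1) / 2)
    swap
    · rw [mixed_empty h]
      simp only [measureReal_empty]
      have := stayProb_nonneg G (m + 1) k (z.1.1 + d)
      positivity
    obtain ⟨e, rfl⟩ : ∃ e, d = e + 1 := ⟨d - 1, by have := h.1; omega⟩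
    have hmid : (z.1.1 + w.1.1) / 2 = z.1.1 + ((e + 1 : ℕ) : ℤ) := by rw [hd]; omega
    rw [mixed_succ_eq h.1 h.2, measureReal_splitSet ρ hw (fun e => by simp [e] at h)]
    rotate_left
    · intro a b
      split_ifs
      · exact measurableSet_forall_surv _ _
      · exact measurableSet_mixed _ _ _ _ _
    · intro a b
      split_ifs
      · exact dependsOnCoords_forall_surv (z := move z (lo a)) (w := move w (hi b)) (by simp [hw])
      · exact dependsOnCoords_mixed G m (k + 1) (z := move z (lo a)) (w := move w (hi b))
          (by simp [hw])
    rw [stayProb_succ, if_pos (hmid ▸ h.2), lazy]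
    set P := Measure.infinitePi fun _ : Site => ρ
    have s11 := measureReal_forall_surv_le hp0 hp1 hρ (e + 1) (z := move z 1) (w := move w 1)
      (by simp [hw]) (by simp [hd]; ring)
    have s12 := measureReal_forall_surv_le hp0 hp1 hρ e (z := move z 1) (w := move w (-1))
      (by simp [hw]) (by simp [hd]; ring)
    have s21 := measureReal_forall_surv_le hp0 hp1 hρ (e + 2) (z := move z (-1)) (w := move w 1)
      (by simp [hw]) (by simp [hd]; ring)
    have s22 := measureReal_forall_surv_le hp0 hp1 hρ (e + 1) (z := move z (-1))
      (w := move w (-1)) (by simp [hw]) (by simp [hd]; ring)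
    have m11 := ih (k + 1) (e + 1) (z := move z 1) (w := move w 1)
      (by simp [hw]) (by simp [hd]; ring)
    have m12 := ih (k + 1) e (z := move z 1) (w := move w (-1))
      (by simp [hw]) (by simp [hd]; ring)
    have m21 := ih (k + 1) (e + 2) (z := move z (-1)) (w := move w 1)
      (by simp [hw]) (by simp [hd]; ring)
    have m22 := ih (k + 1) (e + 1) (z := move z (-1))
      (w := move w (-1)) (by simp [hw]) (by simp [hd]; ring)
    rw [show (move z 1).1.1 + ((e + 1 : ℕ) : ℤ) = z.1.1 + ((e + 1 : ℕ) : ℤ) + 1 by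
      simp; ring] at m11
    rw [show (move z 1).1.1 + (e : ℤ) = z.1.1 + ((e + 1 : ℕ) : ℤ) by simp; ring] at m12
    rw [show (move z (-1)).1.1 + ((e + 2 : ℕ) : ℤ) = z.1.1 + ((e + 1 : ℕ) : ℤ) by
      simp; ring] at m21
    rw [show (move z (-1)).1.1 + ((e + 1 : ℕ) : ℤ) = z.1.1 + ((e + 1 : ℕ) : ℤ) - 1 by
      simp; ring] at m22
    simp only [sum_states, hρ, lo, hi, if_true, Bool.false_eq_true, if_false, or_self, or_true,
      true_or]
    have n1 := stayProb_nonneg G m (k + 1) (z.1.1 + ((e + 1 : ℕ) : ℤ) + 1)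
    have n2 := stayProb_nonneg G m (k + 1) (z.1.1 + ((e + 1 : ℕ) : ℤ) - 1)
    have n3 := stayProb_nonneg G m (k + 1) (z.1.1 + ((e + 1 : ℕ) : ℤ))
    generalize stayProb G m (k + 1) (z.1.1 + ((e + 1 : ℕ) : ℤ) + 1) = q1 at *
    generalize stayProb G m (k + 1) (z.1.1 + ((e + 1 : ℕ) : ℤ) - 1) = q2 at *
    generalize stayProb G m (k + 1) (z.1.1 + ((e + 1 : ℕ) : ℤ)) = q3 at *
    generalize P.real {η | ∀ n, Surv η n (move z 1) (move w 1)} = S11 at *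
    generalize P.real {η | ∀ n, Surv η n (move z 1) (move w (-1))} = S12 at *
    generalize P.real {η | ∀ n, Surv η n (move z (-1)) (move w 1)} = S21 at *
    generalize P.real {η | ∀ n, Surv η n (move z (-1)) (move w (-1))} = S22 at *
    generalize P.real {η | Mixed G η m (k + 1) (move z 1) (move w 1)} = M11 at *
    generalize P.real {η | Mixed G η m (k + 1) (move z 1) (move w (-1))} = M12 at *
    generalize P.real {η | Mixed G η m (k + 1) (move z (-1)) (move w 1)} = M21 at *
    generalize P.real {η | Mixed G η m (k + 1) (move z (-1)) (move w (-1))} = M22 at *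
    push_cast at *
    clear ih h hmid hρ
    have hm0 : (0 : ℝ) ≤ m := Nat.cast_nonneg m
    have he0 : (0 : ℝ) ≤ e := Nat.cast_nonneg e
    have t21 := mul_le_mul_of_nonneg_left s21 hp0.le
    have hp' : 0 ≤ p * (1 - p) / 2 := by
      have := mul_nonneg hp0.le (sub_nonneg.2 hp1)
      linarith
    have b22 : S22 ≤ 4 * (e + 2) * p := s22.trans (by nlinarith)
    have b11 : S11 ≤ 4 * (e + 2) * p := s11.trans (by nlinarith)
    have t22 := mul_le_mul_of_nonneg_left b22 hp'
    have t11 := mul_le_mul_of_nonneg_left b11 hp'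
    have hS : p * S21 + p * (1 - p) / 2 * S22 + p * (1 - p) / 2 * S11 ≤
        4 * p * (2 * p * (e + 2)) := by
      have : 0 ≤ p * p * (4 * (e + 2) * p) := by positivity
      linarith
    -- Here the martingale property enters: the weights `e` and `e + 2` of `q3` add up to `2 (e +
    -- 1)`.
    have hM : (M11 + M12 + M21 + M22) / 4 ≤
        4 * p * ((e + 1) * ((q1 + q2 + 2 * q3) / 4) + 2 * p * m * (e + 1 + m)) := by
      linarith
    have hR : 0 ≤ 4 * p * ((e + 1) * ((q1 + q2 + 2 * q3) / 4) + 2 * p * m * (e + 1 + m)) := by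
      positivity
    have h1p : 0 ≤ (1 - p) ^ 2 := sq_nonneg _
    have h1p' : (1 - p) ^ 2 ≤ 1 := by nlinarith
    have tM := (mul_le_mul_of_nonneg_left hM h1p).trans (mul_le_of_le_one_left hR h1p')
    have hc : 4 * p * (2 * p * (e + 2)) + 4 * p * ((e + 1) * ((q1 + q2 + 2 * q3) / 4) +
        2 * p * m * (e + 1 + m)) ≤ 4 * p * ((e + 1) * ((q1 + q2 + 2 * q3) / 4) +
        2 * p * (m + 1) * (e + 1 + (m + 1))) := by
      have : 0 ≤ p * p * m := by positivity
      linarith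
    refine le_trans (le_of_eq ?_) ((add_le_add hS tM).trans hc)
    ring

end Estimate

/-! ### Stationarity of a single Poisson clock with its arrows. -/

section Clock

/-- The driving data at one site: waiting times and arrows. -/
abbrev Clock : Type := ℕ → ℝ × ℤˣ

/-- The law of one waiting time and one arrow. -/
noncomputable abbrev tickLaw : Measure (ℝ × ℤˣ) := (expMeasure 1).prod signLaw

instance : IsProbabilityMeasure (expMeasure 1) := isProbabilityMeasure_expMeasure one_pos

instance : IsProbabilityMeasure signLaw := by unfold signLaw; infer_instance

/-- The law of the driving data at one site. -/
noncomputable abbrev clockLaw : Measure Clock := Measure.infinitePi fun _ : ℕ => tickLaw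

theorem expMeasure_Iic (s : ℝ) :
    (expMeasure 1) (Set.Iic s) = ENNReal.ofReal (if 0 ≤ s then 1 - Real.exp (-s) else 0) := by
  have h := cdf_expMeasure_eq one_pos s
  rw [cdf_eq_real, one_mul] at h
  rw [← ofReal_measureReal, h]

theorem expMeasure_Ioi {s : ℝ} (hs : 0 ≤ s) :
    (expMeasure 1) (Set.Ioi s) = ENNReal.ofReal (Real.exp (-s)) := by
  rw [← Set.compl_Iic, measure_compl measurableSet_Iic (measure_ne_top _ _), expMeasure_Iic,
    if_pos hs, measure_univ, ← ENNReal.ofReal_one, ← ENNReal.ofReal_sub _ (by simp [hs])]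
  ring_nf

/-- The memoryless property of the exponential law. -/
theorem map_sub_expMeasure {s : ℝ} (hs : 0 ≤ s) :
    ((expMeasure 1).restrict (Set.Ioi s)).map (fun w => w - s) =
      ENNReal.ofReal (Real.exp (-s)) • expMeasure 1 := by
  have hm : Measurable fun w : ℝ => w - s := measurable_id.sub_const s
  refine Measure.ext_of_Iic _ _ fun x => ?_
  rw [Measure.map_apply hm measurableSet_Iic,
    Measure.restrict_apply (hm measurableSet_Iic), Measure.smul_apply, smul_eq_mul,
    expMeasure_Iic]
  have hset : (fun w : ℝ => w - s) ⁻¹' Set.Iic x ∩ Set.Ioi s = Set.Iic (s + x) \ Set.Iic s := by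
    ext w
    simp only [Set.mem_inter_iff, Set.mem_preimage, Set.mem_Iic, Set.mem_Ioi, Set.mem_sdiff, not_le]
    constructor <;> rintro ⟨h1, h2⟩ <;> exact ⟨by linarith, h2⟩
  rw [hset]
  rcases lt_or_ge x 0 with hx | hx
  · rw [if_neg (not_le.2 hx), Set.sdiff_eq_empty.2 (Set.Iic_subset_Iic.2 (by linarith))]
    simp
  · rw [measure_sdiff (Set.Iic_subset_Iic.2 (by linarith)) nullMeasurableSet_Iic
      (measure_ne_top _ _), expMeasure_Iic, expMeasure_Iic, if_pos hx, if_pos hs,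
      if_pos (by linarith), ← ENNReal.ofReal_sub _ (by simp [hs]),
      ← ENNReal.ofReal_mul (Real.exp_pos _).le, neg_add, Real.exp_add]
    congr 1
    ring

/-- Prepend a tick. -/
def consClock (a : ℝ × ℤˣ) (x : Clock) : Clock := fun n => Nat.casesOn n a x

@[simp] theorem consClock_zero (a : ℝ × ℤˣ) (x : Clock) : consClock a x 0 = a := rfl

@[simp] theorem consClock_succ (a : ℝ × ℤˣ) (x : Clock) (n : ℕ) :
    consClock a x (n + 1) = x n := rfl

theorem measurable_consClock : Measurable fun q : (ℝ × ℤˣ) × Clock => consClock q.1 q.2 := by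
  refine measurable_pi_lambda _ fun n => ?_
  cases n with
  | zero => exact measurable_fst
  | succ n => exact (measurable_pi_apply n).comp measurable_snd

theorem map_consClock :
    (tickLaw.prod clockLaw).map (fun q => consClock q.1 q.2) = clockLaw := by
  classical
  refine Measure.eq_infinitePi _ fun s t ht => ?_
  have hs : MeasurableSet (Set.pi (s : Set ℕ) t) := .pi s.countable_toSet fun i _ => ht i
  rw [Measure.map_apply measurable_consClock hs]
  have hpre : (fun q : (ℝ × ℤˣ) × Clock => consClock q.1 q.2) ⁻¹' (Set.pi (s : Set ℕ) t) =
      (if 0 ∈ s then t 0 else Set.univ) ×ˢ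
        Set.pi ((s.preimage Nat.succ (Nat.succ_injective.injOn) : Finset ℕ) : Set ℕ)
          (fun i => t (i + 1)) := by
    ext ⟨a, x⟩
    simp only [Set.mem_preimage, Set.mem_pi, Set.mem_prod, Finset.mem_coe, Finset.mem_preimage]
    constructor
    · intro h
      refine ⟨?_, fun i hi => h (i + 1) hi⟩
      split_ifs with h0
      · exact h 0 h0
      · trivial
    · rintro ⟨h0, h⟩ i hi
      cases i with
      | zero => simpa [hi] using h0
      | succ i => exact h i hi
  rw [hpre, Measure.prod_prod, Measure.infinitePi_pi _ fun i _ => ht (i + 1)]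
  have h1 := Finset.prod_preimage Nat.succ s (Nat.succ_injective.injOn)
    (fun i => if i = 0 then 1 else tickLaw (t i)) (by
      intro x _ hx
      cases x with
      | zero => simp
      | succ x => exact absurd ⟨x, rfl⟩ hx)
  simp only [Nat.succ_eq_add_one, Nat.add_eq_zero_iff, one_ne_zero, and_false, if_false] at h1
  rw [h1]
  by_cases h0 : 0 ∈ s
  · rw [if_pos h0, ← Finset.mul_prod_erase s _ h0, ← Finset.mul_prod_erase s (fun i => tickLaw (t i)) h0]
    simp only [if_true, one_mul]
    congr 1
    exact Finset.prod_congr rfl fun i hi => by rw [if_neg (Finset.ne_of_mem_erase hi)]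
  · rw [if_neg h0, measure_univ, one_mul]
    exact Finset.prod_congr rfl fun i hi => by
      rw [if_neg fun e : i = 0 => h0 (e ▸ hi)]

theorem clockLaw_apply {E : Set Clock} (hE : MeasurableSet E) :
    clockLaw E = ∫⁻ a, clockLaw {x | consClock a x ∈ E} ∂tickLaw := by
  conv_lhs => rw [← map_consClock]
  rw [Measure.map_apply measurable_consClock hE,
    Measure.prod_apply (measurable_consClock hE)]
  rfl

/-- The time of the `n`-th ring. -/
noncomputable def ringAt (x : Clock) (n : ℕ) : ℝ := ringTime (fun i => (x i).1) n

theorem ringAt_zero (x : Clock) : ringAt x 0 = (x 0).1 := by simp [ringAt, ringTime]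

theorem ringAt_cons_succ (a : ℝ × ℤˣ) (x : Clock) (n : ℕ) :
    ringAt (consClock a x) (n + 1) = a.1 + ringAt x n := by
  simp only [ringAt, ringTime]
  rw [Finset.sum_range_succ']
  simp [add_comm]

theorem measurable_ringAt (n : ℕ) : Measurable fun x : Clock => ringAt x n := by
  unfold ringAt ringTime
  exact Finset.measurable_sum _ fun i _ => measurable_fst.comp (measurable_pi_apply i)

/-- The index of the first ring after time `τ`. -/
noncomputable def nextRing (x : Clock) (τ : ℝ) : ℕ := sInf {n | τ < ringAt x n}

/-- The second alternative is the default value `sInf ∅ = 0` when no ring follows `τ`. -/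
theorem nextRing_eq_iff (x : Clock) (τ : ℝ) (k : ℕ) :
    nextRing x τ = k ↔ (τ < ringAt x k ∧ ∀ i < k, ringAt x i ≤ τ) ∨ (k = 0 ∧ ∀ n, ringAt x n ≤ τ) := by
  unfold nextRing
  rcases Set.eq_empty_or_nonempty {n | τ < ringAt x n} with h | h
  · have h' : ∀ n, ringAt x n ≤ τ := fun n => not_lt.1 fun hn => (h ▸ hn : n ∈ (∅ : Set ℕ))
    rw [h, Nat.sInf_empty]
    constructor
    · rintro rfl; exact Or.inr ⟨rfl, h'⟩
    · rintro (⟨h1, -⟩ | ⟨h1, -⟩)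
      · exact absurd (h' k) (not_le.2 h1)
      · exact h1.symm
  · have h1 : τ < ringAt x (sInf {n | τ < ringAt x n}) := Nat.sInf_mem h
    constructor
    · rintro rfl
      exact Or.inl ⟨h1, fun i hi => not_lt.1 (Nat.notMem_of_lt_sInf hi)⟩
    · rintro (⟨h2, h3⟩ | ⟨-, h2⟩)
      · refine le_antisymm (Nat.sInf_le h2) ?_
        by_contra! hlt
        exact absurd (h3 _ hlt) (not_le.2 h1)
      · exact absurd (h2 _) (not_le.2 h1)

theorem measurable_nextRing : Measurable fun q : Clock × ℝ => nextRing q.1 q.2 := by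
  have hr : ∀ n, Measurable fun q : Clock × ℝ => ringAt q.1 n :=
    fun n => (measurable_ringAt n).comp measurable_fst
  refine measurable_to_countable' fun k => ?_
  have : (fun q : Clock × ℝ => nextRing q.1 q.2) ⁻¹' {k} =
      ({q | q.2 < ringAt q.1 k} ∩ ⋂ i, ⋂ (_ : i < k), {q | ringAt q.1 i ≤ q.2}) ∪
        ({q | k = 0} ∩ ⋂ n, {q | ringAt q.1 n ≤ q.2}) := by
    ext q
    simp [nextRing_eq_iff]
  rw [this]
  refine ((measurableSet_lt measurable_snd (hr k)).inter ?_).union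
    ((MeasurableSet.const _).inter ?_)
  · exact MeasurableSet.iInter fun i => MeasurableSet.iInter fun _ =>
      measurableSet_le (hr i) measurable_snd
  · exact MeasurableSet.iInter fun i => measurableSet_le (hr i) measurable_snd

/-- The driving data seen from dynamical time `τ` onwards. -/
noncomputable def shiftClock (τ : ℝ) (x : Clock) : Clock :=
  consClock (ringAt x (nextRing x τ) - τ, (x (nextRing x τ)).2) fun n => x (nextRing x τ + (n + 1))

theorem shiftClock_apply_zero (τ : ℝ) (x : Clock) :
    shiftClock τ x 0 = (ringAt x (nextRing x τ) - τ, (x (nextRing x τ)).2) := rfl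

theorem shiftClock_apply_succ (τ : ℝ) (x : Clock) (n : ℕ) :
    shiftClock τ x (n + 1) = x (nextRing x τ + (n + 1)) := rfl

theorem measurable_clock_apply : Measurable fun q : Clock × ℕ => q.1 q.2 :=
  measurable_from_prod_countable_left fun n => measurable_pi_apply n

theorem measurable_shiftClock_uncurry :
    Measurable fun q : Clock × ℝ => shiftClock q.2 q.1 := by
  have hr : Measurable fun q : Clock × ℕ => ringAt q.1 q.2 :=
    measurable_from_prod_countable_left fun n => measurable_ringAt n
  have h1 : Measurable fun q : Clock × ℝ => ringAt q.1 (nextRing q.1 q.2) :=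
    hr.comp (measurable_fst.prodMk measurable_nextRing)
  have h2 : ∀ g : Clock × ℝ → ℕ, Measurable g → Measurable fun q : Clock × ℝ => q.1 (g q) :=
    fun g hg => measurable_clock_apply.comp (measurable_fst.prodMk hg)
  refine measurable_pi_lambda _ fun n => ?_
  cases n with
  | zero =>
    simp only [shiftClock_apply_zero]
    exact (h1.sub measurable_snd).prodMk (measurable_snd.comp (h2 _ measurable_nextRing))
  | succ n =>
    simp only [shiftClock_apply_succ]
    exact h2 _ (measurable_nextRing.add_const (n + 1))

theorem measurable_shiftClock (τ : ℝ) : Measurable (shiftClock τ) := by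
  have h : Measurable fun x : Clock => ((x, τ) : Clock × ℝ) := measurable_prodMk_right
  have h2 : ((fun q : Clock × ℝ => shiftClock q.2 q.1) ∘ fun x : Clock => ((x, τ) : Clock × ℝ)) =
      shiftClock τ := by
    funext x
    rw [Function.comp_apply]
  rw [← h2]
  exact measurable_shiftClock_uncurry.comp h

/-- Some ring among the first `k + 1` happens after time `τ`. -/
def ringsAfter (k : ℕ) (τ : ℝ) : Set Clock := {x | ∃ i ≤ k, τ < ringAt x i}

theorem measurableSet_ringsAfter (k : ℕ) (τ : ℝ) : MeasurableSet (ringsAfter k τ) := by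
  have : ringsAfter k τ = ⋃ i, ⋃ (_ : i ≤ k), {x | τ < ringAt x i} := by
    ext x; simp [ringsAfter]
  rw [this]
  exact MeasurableSet.iUnion fun i => MeasurableSet.iUnion fun _ =>
    measurableSet_lt measurable_const (measurable_ringAt i)

theorem shiftClock_cons_of_lt {τ : ℝ} {a : ℝ × ℤˣ} (h : τ < a.1) (x : Clock) :
    shiftClock τ (consClock a x) = consClock (a.1 - τ, a.2) x := by
  have h0 : nextRing (consClock a x) τ = 0 := by
    rw [nextRing_eq_iff]
    exact Or.inl ⟨by simpa [ringAt_zero] using h, by simp⟩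
  unfold shiftClock
  rw [h0, ringAt_zero]
  congr 1
  ext1 n
  rw [zero_add, consClock_succ]

theorem cons_mem_ringsAfter_succ {τ : ℝ} {a : ℝ × ℤˣ} (h : a.1 ≤ τ) (k : ℕ) (x : Clock) :
    consClock a x ∈ ringsAfter (k + 1) τ ↔ x ∈ ringsAfter k (τ - a.1) := by
  constructor
  · rintro ⟨i, hi, hlt⟩
    cases i with
    | zero => rw [ringAt_zero] at hlt; exact absurd hlt (not_lt.2 h)
    | succ i => rw [ringAt_cons_succ] at hlt; exact ⟨i, by omega, by linarith⟩
  · rintro ⟨i, hi, hlt⟩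
    exact ⟨i + 1, by omega, by rw [ringAt_cons_succ]; linarith⟩

theorem shiftClock_cons_of_le {τ : ℝ} {a : ℝ × ℤˣ} (h : a.1 ≤ τ) {k : ℕ} {x : Clock}
    (hx : x ∈ ringsAfter k (τ - a.1)) :
    shiftClock τ (consClock a x) = shiftClock (τ - a.1) x := by
  have h0 : nextRing (consClock a x) τ = nextRing x (τ - a.1) + 1 := by
    obtain ⟨i, -, hi⟩ := hx
    rcases (nextRing_eq_iff x (τ - a.1) _).1 rfl with ⟨h1, h2⟩ | ⟨-, h2⟩
    · rw [nextRing_eq_iff]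
      refine Or.inl ⟨by rw [ringAt_cons_succ]; linarith, fun j hj => ?_⟩
      cases j with
      | zero => simpa [ringAt_zero] using h
      | succ j => rw [ringAt_cons_succ]; linarith [h2 j (by omega)]
    · exact absurd (h2 i) (not_le.2 hi)
  unfold shiftClock
  rw [h0, ringAt_cons_succ, consClock_succ]
  congr 1
  · rw [Prod.mk.injEq]; exact ⟨by ring, rfl⟩
  · ext1 n
    rw [show nextRing x (τ - a.1) + 1 + (n + 1) = nextRing x (τ - a.1) + (n + 1) + 1 by ring,
      consClock_succ]

theorem clockLaw_lt_inter {τ : ℝ} (hτ : 0 ≤ τ) {C : Set Clock} (hC : MeasurableSet C) :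
    ∫⁻ a in {a : ℝ × ℤˣ | τ < a.1}, clockLaw {x | consClock (a.1 - τ, a.2) x ∈ C} ∂tickLaw =
      tickLaw {a | τ < a.1} * clockLaw C := by
  have hr : tickLaw.restrict {a : ℝ × ℤˣ | τ < a.1} =
      ((expMeasure 1).restrict (Set.Ioi τ)).prod signLaw := by
    have : {a : ℝ × ℤˣ | τ < a.1} = Set.Ioi τ ×ˢ Set.univ := by ext; simp
    rw [this, ← Measure.prod_restrict, Measure.restrict_univ]
  have hm : Measurable fun a : ℝ × ℤˣ => (a.1 - τ, a.2) :=
    (measurable_fst.sub_const τ).prodMk measurable_snd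
  have hmap : (tickLaw.restrict {a : ℝ × ℤˣ | τ < a.1}).map (fun a => (a.1 - τ, a.2)) =
      ENNReal.ofReal (Real.exp (-τ)) • tickLaw := by
    rw [hr]
    have h := Measure.map_prod_map ((expMeasure 1).restrict (Set.Ioi τ)) signLaw
      (f := fun w => w - τ) (g := id) (measurable_id.sub_const τ) measurable_id
    rw [Measure.map_id, map_sub_expMeasure hτ, Measure.prod_smul_left] at h
    exact h.symm
  have hg : Measurable fun a : ℝ × ℤˣ => clockLaw {x | consClock a x ∈ C} :=
    measurable_measure_prodMk_left (measurable_consClock hC)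
  have h1 := lintegral_map (μ := tickLaw.restrict {a : ℝ × ℤˣ | τ < a.1}) hg hm
  rw [← h1, hmap, lintegral_smul_measure, ← clockLaw_apply hC]
  have h2 : tickLaw {a : ℝ × ℤˣ | τ < a.1} = ENNReal.ofReal (Real.exp (-τ)) := by
    have : {a : ℝ × ℤˣ | τ < a.1} = Set.Ioi τ ×ˢ Set.univ := by ext; simp
    rw [this, Measure.prod_prod, measure_univ, mul_one, expMeasure_Ioi hτ]
  rw [h2, smul_eq_mul]

/-- Condition on the first tick. If it comes after `τ`, its remaining waiting time is again
exponential, so the shifted clock has the original law; the hypothesis `hk` covers an earlier first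
tick. -/
theorem clockLaw_ringsAfter_inter_of_le (k : ℕ) {τ : ℝ} (hτ : 0 ≤ τ) {C : Set Clock}
    (hC : MeasurableSet C) (hk : ∀ a : ℝ × ℤˣ, a.1 ≤ τ →
      clockLaw {x | consClock a x ∈ ringsAfter k τ ∩ shiftClock τ ⁻¹' C} =
        clockLaw {x | consClock a x ∈ ringsAfter k τ} * clockLaw C) :
    clockLaw (ringsAfter k τ ∩ shiftClock τ ⁻¹' C) = clockLaw (ringsAfter k τ) * clockLaw C := by
  have hlt' : MeasurableSet {a : ℝ × ℤˣ | τ < a.1} :=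
    measurableSet_lt measurable_const measurable_fst
  have hmem : ∀ a : ℝ × ℤˣ, τ < a.1 → ∀ x, consClock a x ∈ ringsAfter k τ := fun a ha x =>
    ⟨0, Nat.zero_le k, by rwa [ringAt_zero]⟩
  have hE := (measurableSet_ringsAfter k τ).inter (measurable_shiftClock τ hC)
  rw [clockLaw_apply hE, clockLaw_apply (measurableSet_ringsAfter k τ),
    ← lintegral_add_compl _ hlt', ← lintegral_add_compl (fun a => clockLaw
      {x | consClock a x ∈ ringsAfter k τ}) hlt', add_mul]
  congr 1
  · rw [setLIntegral_congr_fun (g := fun a => clockLaw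
      {x | consClock (a.1 - τ, a.2) x ∈ C}) hlt' fun a ha => ?_, clockLaw_lt_inter hτ hC,
      setLIntegral_congr_fun (g := fun _ => 1) hlt' fun a ha => ?_, setLIntegral_one]
    · have : {x | consClock a x ∈ ringsAfter k τ} = Set.univ :=
        Set.eq_univ_of_forall fun x => hmem a ha x
      simp only [this, measure_univ]
    · congr 1
      ext x
      simp only [Set.mem_inter_iff, Set.mem_ofPred_eq, Set.mem_preimage, hmem a ha x, true_and,
        shiftClock_cons_of_lt ha]
  · have hR : Measurable fun a => clockLaw {x | consClock a x ∈ ringsAfter k τ} :=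
      measurable_measure_prodMk_left (measurable_consClock (measurableSet_ringsAfter k τ))
    rw [← lintegral_mul_const _ hR]
    exact setLIntegral_congr_fun hlt'.compl fun a ha => hk a (not_lt.1 ha)

/-- A first ring before `τ` can be removed, replacing `τ` by `τ - a.1`. Restricting to `ringsAfter k
τ` bounds the number of removals and makes this an induction. -/
theorem clockLaw_ringsAfter_inter (k : ℕ) {τ : ℝ} (hτ : 0 ≤ τ) {C : Set Clock}
    (hC : MeasurableSet C) :
    clockLaw (ringsAfter k τ ∩ shiftClock τ ⁻¹' C) = clockLaw (ringsAfter k τ) * clockLaw C := by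
  induction k generalizing τ with
  | zero =>
    refine clockLaw_ringsAfter_inter_of_le 0 hτ hC fun a ha => ?_
    have : ∀ x, consClock a x ∉ ringsAfter 0 τ := by
      rintro x ⟨i, hi, hx⟩
      obtain rfl : i = 0 := by omega
      rw [ringAt_zero] at hx
      exact absurd hx (not_lt.2 ha)
    simp [this]
  | succ k ih =>
    refine clockLaw_ringsAfter_inter_of_le (k + 1) hτ hC fun a ha => ?_
    have h1 : {x | consClock a x ∈ ringsAfter (k + 1) τ} = ringsAfter k (τ - a.1) := by
      ext x
      exact cons_mem_ringsAfter_succ ha k x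
    have h2 : {x | consClock a x ∈ ringsAfter (k + 1) τ ∩ shiftClock τ ⁻¹' C} =
        ringsAfter k (τ - a.1) ∩ shiftClock (τ - a.1) ⁻¹' C := by
      ext x
      simp only [Set.mem_ofPred_eq, Set.mem_inter_iff, cons_mem_ringsAfter_succ ha,
        Set.mem_preimage]
      refine and_congr_right fun hx => ?_
      rw [shiftClock_cons_of_le ha hx]
    rw [h1, h2]
    exact ih (by linarith)

/-- Positive waiting times that are unbounded. -/
def GoodClock (x : Clock) : Prop := (∀ i, 0 < (x i).1) ∧ ∀ M : ℕ, ∃ i, (M : ℝ) < (x i).1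

theorem ae_goodClock : ∀ᵐ x ∂clockLaw, GoodClock x := by
  have hev : ∀ i, MeasurePreserving (fun x : Clock => x i) clockLaw tickLaw :=
    fun i => measurePreserving_eval_infinitePi (fun _ : ℕ => tickLaw) i
  have hIic : ∀ s : ℝ, tickLaw {a | a.1 ≤ s} = (expMeasure 1) (Set.Iic s) := by
    intro s
    have : {a : ℝ × ℤˣ | a.1 ≤ s} = Set.Iic s ×ˢ Set.univ := by ext; simp
    rw [this, Measure.prod_prod, measure_univ, mul_one]
  have hms : ∀ s : ℝ, MeasurableSet {a : ℝ × ℤˣ | a.1 ≤ s} := fun s =>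
    measurableSet_le measurable_fst measurable_const
  refine Filter.Eventually.and ?_ ?_
  · rw [ae_all_iff]
    intro i
    rw [ae_iff]
    have h := (hev i).measure_preimage (hms 0).nullMeasurableSet
    rw [hIic, expMeasure_Iic] at h
    simpa [Set.preimage] using h
  · rw [ae_all_iff]
    intro M
    rw [ae_iff]
    set r : ENNReal := tickLaw {a | a.1 ≤ (M : ℝ)} with hr
    have hr1 : r < 1 := by
      rw [hr, hIic, expMeasure_Iic, if_pos (Nat.cast_nonneg M), ENNReal.ofReal_lt_one]
      linarith [Real.exp_pos (-(M : ℝ))]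
    have hle : ∀ n : ℕ, clockLaw {x | ¬ ∃ i, (M : ℝ) < (x i).1} ≤ r ^ n := by
      intro n
      have h := Measure.infinitePi_pi (fun _ : ℕ => tickLaw) (s := Finset.range n)
        (t := fun _ => {a | a.1 ≤ (M : ℝ)}) fun i _ => hms M
      rw [Finset.prod_const, Finset.card_range] at h
      rw [← h]
      refine measure_mono fun x hx i _ => ?_
      simp only [Set.mem_ofPred_eq, not_exists, not_lt] at hx
      exact hx i
    exact le_antisymm (ge_of_tendsto' (ENNReal.tendsto_pow_atTop_nhds_zero_of_lt_one hr1) hle)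
      zero_le

theorem GoodClock.le_ringAt {x : Clock} (h : GoodClock x) (n : ℕ) : (x n).1 ≤ ringAt x n := by
  unfold ringAt ringTime
  rw [Finset.sum_range_succ]
  have := Finset.sum_nonneg (s := Finset.range n) (f := fun i => (x i).1) fun i _ => (h.1 i).le
  linarith

theorem GoodClock.strictMono {x : Clock} (h : GoodClock x) : StrictMono (ringAt x) := by
  refine strictMono_nat_of_lt_succ fun n => ?_
  unfold ringAt ringTime
  rw [Finset.sum_range_succ _ (n + 1)]
  have := h.1 (n + 1)
  linarith

theorem GoodClock.exists_lt_ringAt {x : Clock} (h : GoodClock x) (τ : ℝ) : ∃ n, τ < ringAt x n := by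
  obtain ⟨M, hM⟩ := exists_nat_ge τ
  obtain ⟨i, hi⟩ := h.2 M
  exact ⟨i, (hM.trans_lt hi).trans_le (h.le_ringAt i)⟩

/-- Shifting dynamical time preserves the law of the driving data at one site. -/
theorem measurePreserving_shiftClock {τ : ℝ} (hτ : 0 ≤ τ) :
    MeasurePreserving (shiftClock τ) clockLaw clockLaw := by
  refine ⟨measurable_shiftClock τ, Measure.ext fun C hC => ?_⟩
  rw [Measure.map_apply (measurable_shiftClock τ) hC]
  have hmono : Monotone fun k => ringsAfter k τ := fun k l hkl x ⟨i, hi, hx⟩ =>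
    ⟨i, hi.trans hkl, hx⟩
  have hfull : ∀ E : Set Clock, clockLaw (⋃ k, ringsAfter k τ ∩ E) = clockLaw E := by
    intro E
    refine measure_congr ?_
    filter_upwards [ae_goodClock] with x hx
    apply propext
    change x ∈ (⋃ k, ringsAfter k τ ∩ E) ↔ x ∈ E
    simp only [Set.mem_iUnion, Set.mem_inter_iff, exists_and_right]
    obtain ⟨n, hn⟩ := hx.exists_lt_ringAt τ
    exact ⟨fun h => h.2, fun h => ⟨⟨n, n, le_rfl, hn⟩, h⟩⟩
  have h1 : clockLaw (shiftClock τ ⁻¹' C) =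
      ⨆ k, clockLaw (ringsAfter k τ ∩ shiftClock τ ⁻¹' C) := by
    rw [← hfull, Monotone.measure_iUnion]
    exact fun k l hkl => Set.inter_subset_inter_left _ (hmono hkl)
  have h2 : (1 : ENNReal) = ⨆ k, clockLaw (ringsAfter k τ) := by
    rw [← hmono.measure_iUnion]
    have := hfull Set.univ
    simpa using this.symm
  rw [h1]
  simp_rw [clockLaw_ringsAfter_inter _ hτ hC]
  rw [← ENNReal.iSup_mul, ← h2, one_mul]

/-- The arrow at a site at dynamical time `τ`. -/
noncomputable def arrowAt (x : Clock) (τ : ℝ) : ℤˣ := (x (nextRing x τ)).2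

/-- Only finitely many rings precede `τ` on a good clock, so `ncard` is a true count and not the
default value 0 of an infinite set. -/
theorem GoodClock.ringCount_eq {x : Clock} (h : GoodClock x) (τ : ℝ≥0) :
    ringCount (fun n => (x n).1) τ = nextRing x τ := by
  have : {n : ℕ | ringTime (fun n => (x n).1) n ≤ (τ : ℝ)} =
      (Finset.range (nextRing x τ) : Set ℕ) := by
    ext n
    simp only [Set.mem_ofPred_eq, Finset.coe_range, Set.mem_Iio]
    change ringAt x n ≤ τ ↔ _
    obtain ⟨i, hi⟩ := h.exists_lt_ringAt τ
    rcases (nextRing_eq_iff x τ _).1 rfl with ⟨h1, h2⟩ | ⟨-, h2⟩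
    · refine ⟨fun hn => ?_, h2 n⟩
      by_contra! hcon
      exact absurd (h.strictMono.monotone hcon) (not_le.2 (hn.trans_lt h1))
    · exact absurd (h2 i) (not_le.2 hi)
  rw [ringCount, this, Set.ncard_coe_finset, Finset.card_range]

theorem ringAt_shiftClock (x : Clock) (τ : ℝ) (n : ℕ) :
    ringAt (shiftClock τ x) n = ringAt x (nextRing x τ + n) - τ := by
  induction n with
  | zero => simp [ringAt_zero, shiftClock]
  | succ n ih =>
    have hs : ∀ (y : Clock) k, ringAt y (k + 1) = ringAt y k + (y (k + 1)).1 := fun y k =>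
      Finset.sum_range_succ _ _
    rw [hs, ih, ← add_assoc, hs]
    simp only [shiftClock, consClock_succ]
    rw [← add_assoc]
    ring

theorem GoodClock.arrowAt_shiftClock {x : Clock} (h : GoodClock x) {τ σ : ℝ} (hσ : 0 ≤ σ) :
    arrowAt (shiftClock τ x) σ = arrowAt x (τ + σ) := by
  have key : nextRing x (τ + σ) = nextRing x τ + nextRing (shiftClock τ x) σ := by
    obtain ⟨i, hi⟩ := h.exists_lt_ringAt (τ + σ)
    have hex : ∃ k, σ < ringAt (shiftClock τ x) k := by
      refine ⟨i, ?_⟩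
      rw [ringAt_shiftClock]
      have := h.strictMono.monotone (show i ≤ nextRing x τ + i by omega)
      linarith
    obtain ⟨k, hk⟩ := hex
    rcases (nextRing_eq_iff (shiftClock τ x) σ _).1 rfl with ⟨h1, h2⟩ | ⟨-, h2⟩
    swap
    · exact absurd (h2 k) (not_le.2 hk)
    rcases (nextRing_eq_iff x τ _).1 rfl with ⟨h3, h4⟩ | ⟨-, h4⟩
    swap
    · exact absurd (h4 i) (not_le.2 (by linarith))
    rw [nextRing_eq_iff]
    rw [ringAt_shiftClock] at h1
    refine Or.inl ⟨by linarith, fun j hj => ?_⟩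
    rcases lt_or_ge j (nextRing x τ) with hj' | hj'
    · linarith [h4 j hj']
    · have := h2 (j - nextRing x τ) (by omega)
      rw [ringAt_shiftClock, Nat.add_sub_cancel' hj'] at this
      linarith
  unfold arrowAt
  rw [key]
  generalize nextRing (shiftClock τ x) σ = n
  cases n with
  | zero => rfl
  | succ n => rfl

theorem measurable_arrowAt : Measurable fun q : Clock × ℝ => arrowAt q.1 q.2 :=
  measurable_snd.comp (measurable_clock_apply.comp (measurable_fst.prodMk measurable_nextRing))

/-- The state of a site on the dynamical time interval `[0, δ]`. -/
noncomputable def stateOn (δ : ℝ) (x : Clock) : Bool × ℤˣ := (decide ((x 0).1 ≤ δ), (x 0).2)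

theorem arrowAt_of_stateOn {δ τ : ℝ} (hτ : τ ≤ δ) {x : Clock} (h : (stateOn δ x).1 = false) :
    arrowAt x τ = (stateOn δ x).2 := by
  have h1 : δ < (x 0).1 := by simpa [stateOn] using h
  have : nextRing x τ = 0 := by
    rw [nextRing_eq_iff]
    exact Or.inl ⟨by rw [ringAt_zero]; linarith, by simp⟩
  rw [arrowAt, this]
  rfl

theorem signLaw_singleton (s : ℤˣ) : signLaw {s} = 1 / 2 := by
  rw [signLaw, PMF.toMeasure_apply_singleton _ _ (measurableSet_singleton s)]
  simp

theorem measurable_stateOn (δ : ℝ) : Measurable (stateOn δ) := by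
  refine Measurable.prodMk ?_ (measurable_snd.comp (measurable_pi_apply 0))
  refine measurable_to_bool ?_
  have : (fun x : Clock => decide ((x 0).1 ≤ δ)) ⁻¹' {true} = {x | (x 0).1 ≤ δ} := by
    ext x; simp
  rw [this]
  exact measurableSet_le (measurable_fst.comp (measurable_pi_apply 0)) measurable_const

theorem map_stateOn_real {δ : ℝ} (hδ : 0 ≤ δ) (b : Bool) (s : ℤˣ) :
    (clockLaw.map (stateOn δ)).real {(b, s)} =
      (if b then 1 - Real.exp (-δ) else 1 - (1 - Real.exp (-δ))) / 2 := by
  have hev : MeasurePreserving (fun x : Clock => x 0) clockLaw tickLaw :=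
    measurePreserving_eval_infinitePi (fun _ : ℕ => tickLaw) 0
  have hset : stateOn δ ⁻¹' {(b, s)} =
      (fun x : Clock => x 0) ⁻¹' ((if b then Set.Iic δ else Set.Ioi δ) ×ˢ {s}) := by
    ext x
    cases b <;> simp [stateOn, Prod.ext_iff]
  have hm : MeasurableSet (((if b then Set.Iic δ else Set.Ioi δ) ×ˢ {s} : Set (ℝ × ℤˣ))) := by
    refine MeasurableSet.prod ?_ (measurableSet_singleton s)
    split_ifs <;> measurability
  rw [measureReal_def, Measure.map_apply (measurable_stateOn δ) (measurableSet_singleton _), hset,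
    hev.measure_preimage hm.nullMeasurableSet, Measure.prod_prod, signLaw_singleton]
  have h1 : 0 ≤ 1 - Real.exp (-δ) := by simp [hδ]
  cases b
  · simp [expMeasure_Ioi hδ, ENNReal.toReal_mul, (Real.exp_pos _).le, div_eq_mul_inv]
  · simp [expMeasure_Iic, hδ, ENNReal.toReal_mul, h1, div_eq_mul_inv]

end Clock

/-! ### No exceptional times for subdiffusive pairs that fail to coalesce. -/

section Exceptional

/-- The driving data of the whole web. -/
abbrev Data : Type := Site → Clock

/-- The law of the driving data. -/
noncomputable abbrev dataLaw : Measure Data := Measure.infinitePi fun _ : Site => clockLaw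

/-- The arrow configuration at dynamical time `τ`. -/
noncomputable def arrowsOf (x : Data) (τ : ℝ) : Arrows := fun z => arrowAt (x z) τ

/-- The driving data seen from dynamical time `τ` onwards. -/
noncomputable def shiftData (τ : ℝ) (x : Data) : Data := fun z => shiftClock τ (x z)

theorem measurePreserving_shiftData {τ : ℝ} (hτ : 0 ≤ τ) :
    MeasurePreserving (shiftData τ) dataLaw dataLaw := by
  refine ⟨measurable_pi_lambda _ fun z => (measurable_shiftClock τ).comp (measurable_pi_apply z), ?_⟩
  have h := Measure.infinitePi_map_pi (fun _ : Site => clockLaw) fun _ => measurable_shiftClock τ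
  rw [(measurePreserving_shiftClock hτ).map_eq] at h
  exact h

theorem ae_goodData : ∀ᵐ x ∂dataLaw, ∀ z, GoodClock (x z) := by
  rw [ae_all_iff]
  exact fun z => (measurePreserving_eval_infinitePi (fun _ : Site => clockLaw)
    z).quasiMeasurePreserving.ae ae_goodClock

theorem arrowsOf_shiftData {x : Data} (h : ∀ z, GoodClock (x z)) {τ σ : ℝ} (hσ : 0 ≤ σ) :
    arrowsOf (shiftData τ x) σ = arrowsOf x (τ + σ) :=
  funext fun z => (h z).arrowAt_shiftClock hσ

/-- The data for which a property of arrow configurations holds at some dynamical time in `J`. -/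
def existsTime (A : Set Arrows) (J : Set ℝ) : Set Data := {x | ∃ τ ∈ J, arrowsOf x τ ∈ A}

theorem existsTime_iUnion {ι : Sort*} (A : Set Arrows) (J : ι → Set ℝ) :
    existsTime A (⋃ i, J i) = ⋃ i, existsTime A (J i) := by
  ext x
  simp only [existsTime, Set.mem_iUnion, Set.mem_ofPred_eq]
  exact ⟨fun ⟨τ, ⟨i, hi⟩, h⟩ => ⟨i, τ, hi, h⟩, fun ⟨i, τ, hi, h⟩ => ⟨τ, ⟨i, hi⟩, h⟩⟩

theorem preimage_shiftData_existsTime (A : Set Arrows) {J : Set ℝ} (hJ : J ⊆ Set.Ici 0) (a : ℝ) :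
    shiftData a ⁻¹' existsTime A J =ᵐ[dataLaw] existsTime A ((fun τ => a + τ) '' J) := by
  filter_upwards [ae_goodData] with x hx
  apply propext
  change (∃ τ ∈ J, arrowsOf (shiftData a x) τ ∈ A) ↔ ∃ τ ∈ (fun τ => a + τ) '' J, arrowsOf x τ ∈ A
  rw [Set.exists_mem_image]
  exact exists_congr fun τ => and_congr_right fun hτ => by rw [arrowsOf_shiftData hx (hJ hτ)]

/-- The set `A` is arbitrary, so these are outer measures; a measurable hull gives the inequality
that the union bound needs. -/
theorem measure_existsTime_image_le (A : Set Arrows) {J : Set ℝ} (hJ : J ⊆ Set.Ici 0) {a : ℝ}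
    (ha : 0 ≤ a) : dataLaw (existsTime A ((fun τ => a + τ) '' J)) ≤ dataLaw (existsTime A J) := by
  rw [← measure_congr (preimage_shiftData_existsTime A hJ a)]
  have hs := measurePreserving_shiftData ha
  calc dataLaw (shiftData a ⁻¹' existsTime A J)
      ≤ dataLaw (shiftData a ⁻¹' toMeasurable dataLaw (existsTime A J)) :=
        measure_mono (Set.preimage_mono (subset_toMeasurable _ _))
    _ = dataLaw (existsTime A J) := by
        rw [hs.measure_preimage (measurableSet_toMeasurable _ _).nullMeasurableSet,
          measure_toMeasurable]

/-- The configurations in which the paths from `z` and `w` do not coalesce and their midpoints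
after `n` steps lie in `G n`. -/
def apartWithin (G : ℕ → ℤ → Prop) (z w : Site) : Set Arrows :=
  {ξ | ¬ Coalesce ξ z w ∧ ∀ n, G n (((siteAfter ξ z n).1.1 + (siteAfter ξ w n).1.1) / 2)}

/-- The event `Mixed` for the states on `[0, δ]` does not involve `τ`, so it covers all times of the
window at once. -/
theorem measure_apartWithin_le (G : ℕ → ℤ → Prop) (m d : ℕ) {z w : Site} (hw : w.1.2 = z.1.2)
    (hd : w.1.1 = z.1.1 + 2 * d) (hd0 : 0 < d) {δ : ℝ} (hδ : 0 < δ) :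
    dataLaw (existsTime (apartWithin G z w) (Set.Icc 0 δ)) ≤
      ENNReal.ofReal (4 * δ * (d * stayProb G m 0 (z.1.1 + d) + 2 * δ * m * (d + m))) := by
  set p := 1 - Real.exp (-δ) with hp
  have hp0 : 0 < p := by
    have : Real.exp (-δ) < 1 := by rw [Real.exp_lt_one_iff]; linarith
    linarith
  have hp1 : p ≤ 1 := by linarith [Real.exp_pos (-δ)]
  have hpδ : p ≤ δ := by linarith [Real.add_one_le_exp (-δ)]
  have : IsProbabilityMeasure (clockLaw.map (stateOn δ)) :=
    Measure.isProbabilityMeasure_map (measurable_stateOn δ).aemeasurable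
  have hmap := Measure.infinitePi_map_pi (fun _ : Site => clockLaw) fun _ => measurable_stateOn δ
  have hmeas : Measurable fun (x : Data) z => stateOn δ (x z) :=
    measurable_pi_lambda _ fun z => (measurable_stateOn δ).comp (measurable_pi_apply z)
  have hsub : existsTime (apartWithin G z w) (Set.Icc 0 δ) ⊆
      (fun (x : Data) z => stateOn δ (x z)) ⁻¹' {η | Mixed G η m 0 z w} := by
    rintro x ⟨τ, hτ, hc, hG⟩
    refine mixed_of_not_coalesce (ξ := arrowsOf x τ) (fun v hv => arrowAt_of_stateOn hτ.2 hv) G m 0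
      hw (by rw [hd]; omega) hc fun n => ?_
    rw [zero_add]
    exact hG n
  refine (measure_mono hsub).trans ?_
  rw [← Measure.map_apply hmeas (measurableSet_mixed G m 0 z w), hmap, ← ofReal_measureReal]
  refine ENNReal.ofReal_le_ofReal ((measureReal_mixed_le hp0 hp1 (map_stateOn_real hδ.le) G m 0 d
    hw hd).trans ?_)
  have := stayProb_nonneg G m 0 (z.1.1 + d)
  gcongr

theorem Ico_subset_iUnion_Icc (M L : ℕ) (hL : 0 < L) :
    Set.Ico (0 : ℝ) M ⊆ ⋃ i ∈ Finset.range (M * L),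
      (fun τ => (i / L : ℝ) + τ) '' Set.Icc 0 (1 / L : ℝ) := by
  intro τ hτ
  have hL' : (0 : ℝ) < L := by exact_mod_cast hL
  have h1 := Nat.floor_le (mul_nonneg hτ.1 hL'.le)
  have h2 := Nat.lt_floor_add_one (τ * L)
  simp only [Set.mem_iUnion, Finset.mem_range]
  refine ⟨⌊τ * L⌋₊, ?_, τ - ⌊τ * L⌋₊ / L, ⟨?_, ?_⟩, by ring⟩
  · rw [Nat.floor_lt (mul_nonneg hτ.1 hL'.le)]
    push_cast
    exact mul_lt_mul_of_pos_right hτ.2 hL'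
  · rw [sub_nonneg, div_le_iff₀ hL']
    exact h1
  · rw [sub_le_iff_le_add, ← add_div, le_div_iff₀ hL']
    linarith

/-- If the lazy walk leaves `G` almost surely, then there is almost surely no dynamical time at
which the pair of paths stays apart with midpoints in `G`. -/
theorem measure_apartWithin_eq_zero (G : ℕ → ℤ → Prop) (d : ℕ) {z w : Site} (hw : w.1.2 = z.1.2)
    (hd : w.1.1 = z.1.1 + 2 * d) (hd0 : 0 < d)
    (hG : ∀ η : ℝ, 0 < η → ∃ m, stayProb G m 0 (z.1.1 + d) ≤ η) :
    dataLaw (existsTime (apartWithin G z w) (Set.Ici 0)) = 0 := by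
  have hcov : Set.Ici (0 : ℝ) = ⋃ M : ℕ, Set.Ico (0 : ℝ) M := by
    ext τ
    simp only [Set.mem_Ici, Set.mem_iUnion, Set.mem_Ico, exists_and_left]
    exact ⟨fun h => ⟨h, exists_nat_gt τ⟩, fun h => h.1⟩
  rw [hcov, existsTime_iUnion, measure_iUnion_null_iff]
  intro M
  -- There are `M L` windows of length `1 / L`. Their number cancels the leading factor `1 / L`, and
  -- the ring term keeps one more such factor. The mesh tends to 0 with `m` fixed, and only then is
  -- `m` chosen.
  have hL : ∀ m L : ℕ, 0 < L → dataLaw (existsTime (apartWithin G z w) (Set.Ico 0 M)) ≤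
      ENNReal.ofReal (4 * M * (d * stayProb G m 0 (z.1.1 + d) + 2 * m * (d + m) * (1 / L))) := by
    intro m L hL
    have hL' : (0 : ℝ) < L := by exact_mod_cast hL
    have hsub : existsTime (apartWithin G z w) (Set.Ico 0 M) ⊆ ⋃ i ∈ Finset.range (M * L),
        existsTime (apartWithin G z w) ((fun τ => (i / L : ℝ) + τ) '' Set.Icc 0 (1 / L : ℝ)) := by
      rintro x ⟨τ, hτ, hx⟩
      have := Ico_subset_iUnion_Icc M L hL hτ
      simp only [Set.mem_iUnion] at this ⊢
      obtain ⟨i, hi, h⟩ := this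
      exact ⟨i, hi, τ, h, hx⟩
    have h1 := measure_apartWithin_le G m d hw hd hd0 (show (0 : ℝ) < 1 / L by positivity)
    refine (measure_mono hsub).trans ((measure_biUnion_finset_le _ _).trans ?_)
    refine (Finset.sum_le_card_nsmul _ _ _ fun i _ => (measure_existsTime_image_le _
      Set.Icc_subset_Ici_self (by positivity)).trans h1).trans (le_of_eq ?_)
    rw [Finset.card_range, ← ENNReal.ofReal_nsmul]
    congr 1
    rw [nsmul_eq_mul]
    push_cast
    field_simp
  have hm : ∀ m : ℕ, dataLaw (existsTime (apartWithin G z w) (Set.Ico 0 M)) ≤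
      ENNReal.ofReal (4 * M * (d * stayProb G m 0 (z.1.1 + d))) := by
    intro m
    have hlim : Tendsto (fun n : ℕ => ENNReal.ofReal (4 * M * (d * stayProb G m 0 (z.1.1 + d) +
        2 * m * (d + m) * (1 / ((n : ℝ) + 1))))) atTop
        (nhds (ENNReal.ofReal (4 * M * (d * stayProb G m 0 (z.1.1 + d) +
          2 * m * (d + m) * 0)))) :=
      ENNReal.tendsto_ofReal ((tendsto_const_nhds.add
        (tendsto_one_div_add_atTop_nhds_zero_nat.const_mul _)).const_mul _)
    rw [mul_zero, add_zero] at hlim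
    refine ge_of_tendsto' hlim fun n => ?_
    have := hL m (n + 1) n.succ_pos
    push_cast at this
    exact this
  refine le_antisymm (le_of_forall_pos_le_add fun ε hε => ?_) zero_le
  rw [zero_add]
  by_cases hε' : ε = ⊤
  · simp [hε']
  have hε0 : 0 < ε.toReal := ENNReal.toReal_pos hε.ne' hε'
  obtain ⟨m, hm'⟩ := hG (ε.toReal / (4 * M * d + 1)) (by positivity)
  refine (hm m).trans (ENNReal.ofReal_le_of_le_toReal ?_)
  rw [le_div_iff₀ (by positivity)] at hm'
  have := stayProb_nonneg G m 0 (z.1.1 + d)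
  nlinarith

/-- The path from `z` satisfies a `K`-subdiffusive bound. -/
def Sub (K : ℝ) (ξ : Arrows) (z : Site) : Prop :=
  ∃ j : ℕ, ∀ n : ℕ, |((siteAfter ξ z n).1.1 : ℝ)| ≤ j + K * √(n : ℝ)

theorem lt_of_not_coalesce {ξ : Arrows} {z w : Site} (hw : w.1.2 = z.1.2) (h : z.1.1 < w.1.1)
    (hc : ¬ Coalesce ξ z w) (n : ℕ) : (siteAfter ξ z n).1.1 < (siteAfter ξ w n).1.1 := by
  induction n with
  | zero => exact h
  | succ n ih =>
    have hne : siteAfter ξ z (n + 1) ≠ siteAfter ξ w (n + 1) := fun e => hc ⟨n + 1, e⟩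
    have hne' : (siteAfter ξ z (n + 1)).1.1 ≠ (siteAfter ξ w (n + 1)).1.1 := fun e =>
      hne (site_ext e (by simp [hw]))
    have pz := site_parity (siteAfter ξ z n)
    have pw := site_parity (siteAfter ξ w n)
    rw [siteAfter_snd] at pz pw
    rw [siteAfter_succ', siteAfter_succ', step_eq_move, step_eq_move, move_fst, move_fst] at hne' ⊢
    have uz := unit_abs_le (ξ (siteAfter ξ z n))
    have uw := unit_abs_le (ξ (siteAfter ξ w n))
    omega

/-- Almost surely, at every dynamical time, every path with a `K`-subdiffusive bound coalesces
with all other paths started at the same level. -/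
theorem ae_coalesce_of_sub : ∀ᵐ x ∂dataLaw, ∀ τ : ℝ, 0 ≤ τ → ∀ z w : Site, w.1.2 = z.1.2 →
    ∀ K : ℕ, Sub K (arrowsOf x τ) z → Coalesce (arrowsOf x τ) z w := by
  have hlow : ∀ z w : Site, w.1.2 = z.1.2 → z.1.1 < w.1.1 → ∀ K j : ℕ, ∀ᵐ x ∂dataLaw,
      (x ∉ existsTime (apartWithin (fun k u => -(j : ℝ) - (K : ℝ) * √(k : ℝ) ≤ (u : ℝ)) z w)
        (Set.Ici 0)) ∧
      x ∉ existsTime (apartWithin (fun k u => (u : ℝ) ≤ j + (K : ℝ) * √(k : ℝ)) z w)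
        (Set.Ici 0) := by
    intro z w hw hzw K j
    have pz := site_parity z
    have pw := site_parity w
    obtain ⟨d, hd⟩ : ∃ d : ℕ, w.1.1 = z.1.1 + 2 * d := ⟨((w.1.1 - z.1.1) / 2).toNat, by omega⟩
    have hd0 : 0 < d := by omega
    refine Filter.Eventually.and ?_ ?_ <;> refine measure_eq_zero_iff_ae_notMem.1 ?_
    · exact measure_apartWithin_eq_zero _ d hw hd hd0 fun η hη =>
        exists_stayProb_lower_le K (Nat.cast_nonneg K) j 0 _ hη
    · exact measure_apartWithin_eq_zero _ d hw hd hd0 fun η hη =>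
        exists_stayProb_upper_le K (Nat.cast_nonneg K) j 0 _ hη
  have hall : ∀ᵐ x ∂dataLaw, ∀ z w : Site, w.1.2 = z.1.2 → z.1.1 < w.1.1 → ∀ K j : ℕ,
      (x ∉ existsTime (apartWithin (fun k u => -(j : ℝ) - (K : ℝ) * √(k : ℝ) ≤ (u : ℝ)) z w)
        (Set.Ici 0)) ∧
      x ∉ existsTime (apartWithin (fun k u => (u : ℝ) ≤ j + (K : ℝ) * √(k : ℝ)) z w)
        (Set.Ici 0) := by
    simp only [ae_all_iff]
    exact hlow
  filter_upwards [hall] with x hx τ hτ z w hw K hK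
  obtain ⟨j, hj⟩ := hK
  by_contra hc
  -- The midpoint lies between the two paths, so the bound on the path from `z` confines it on one
  -- side: from below if `z` is on the left, from above if on the right. Nothing is needed about the
  -- path from `w`.
  rcases lt_trichotomy z.1.1 w.1.1 with h | h | h
  · refine (hx z w hw h K j).1 ⟨τ, hτ, hc, fun n => ?_⟩
    have h1 := lt_of_not_coalesce hw h hc n
    have h2 : (siteAfter (arrowsOf x τ) z n).1.1 ≤
      ((siteAfter (arrowsOf x τ) z n).1.1 + (siteAfter (arrowsOf x τ) w n).1.1) / 2 := by omega
    have h3 := neg_abs_le ((siteAfter (arrowsOf x τ) z n).1.1 : ℝ)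
    have h4 := hj n
    have h5 : ((siteAfter (arrowsOf x τ) z n).1.1 : ℝ) ≤ ((((siteAfter (arrowsOf x τ) z n).1.1 +
      (siteAfter (arrowsOf x τ) w n).1.1) / 2 : ℤ) : ℝ) := by exact_mod_cast h2
    linarith
  · exact hc ⟨0, site_ext h hw.symm⟩
  · have hc' : ¬ Coalesce (arrowsOf x τ) w z := fun ⟨n, hn⟩ => hc ⟨n, hn.symm⟩
    refine (hx w z hw.symm h K j).2 ⟨τ, hτ, hc', fun n => ?_⟩
    have h1 := lt_of_not_coalesce hw.symm h hc' n
    have h2 : ((siteAfter (arrowsOf x τ) w n).1.1 + (siteAfter (arrowsOf x τ) z n).1.1) / 2 ≤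
      (siteAfter (arrowsOf x τ) z n).1.1 := by omega
    have h3 := le_abs_self ((siteAfter (arrowsOf x τ) z n).1.1 : ℝ)
    have h4 := hj n
    have h5 : ((((siteAfter (arrowsOf x τ) w n).1.1 + (siteAfter (arrowsOf x τ) z n).1.1) / 2 : ℤ)
      : ℝ) ≤ ((siteAfter (arrowsOf x τ) z n).1.1 : ℝ) := by exact_mod_cast h2
    linarith

end Exceptional

/-! ### The empty-or-dense dichotomy. -/

section Dichotomy

theorem measurable_arrowsOf : Measurable fun q : Data × ℝ => arrowsOf q.1 q.2 := by
  refine measurable_pi_lambda _ fun z => ?_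
  have h : Measurable fun q : Data × ℝ => (q.1 z, q.2) :=
    ((measurable_pi_apply z).comp measurable_fst).prodMk measurable_snd
  exact measurable_arrowAt.comp h

theorem measurable_siteAfter (z : Site) (n : ℕ) : Measurable fun ξ : Arrows => siteAfter ξ z n := by
  induction n with
  | zero => exact measurable_const
  | succ n ih =>
    simp only [siteAfter_succ']
    have h : Measurable fun q : Arrows × Site => step q.1 q.2 :=
      measurable_from_prod_countable_left fun w => by
        have : (fun ξ : Arrows => step ξ w) = (move w) ∘ fun ξ => ξ w := rfl
        rw [this]
        exact (measurable_of_countable _).comp (measurable_pi_apply w)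
    exact h.comp (measurable_id.prodMk ih)

/-- The uncountable union over `τ` is a projection of a Borel set. All finite `ν` are needed because
the zero-one law uses image measures of `dataLaw`. -/
theorem nullMeasurableSet_existsTime {A : Set Arrows} (hA : MeasurableSet A) {J : Set ℝ}
    (hJ : MeasurableSet J) (ν : Measure Data) [IsFiniteMeasure ν] :
    NullMeasurableSet (existsTime A J) ν := by
  have hm : MeasurableSet ((Prod.snd ⁻¹' J) ∩ (fun q : Data × ℝ => arrowsOf q.1 q.2) ⁻¹' A) :=
    (measurable_snd hJ).inter (measurable_arrowsOf hA)
  have himg : existsTime A J = Prod.fst ''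
      ((Prod.snd ⁻¹' J) ∩ (fun q : Data × ℝ => arrowsOf q.1 q.2) ⁻¹' A) := by
    ext x
    simp [existsTime]
  rw [himg]
  exact nullMeasurableSet_image_fst ν hm

/-- A property of the path from a site that is inherited along the path in both directions, is
measurable, and implies a subdiffusive bound. -/
structure IsPathProperty (Q : Arrows → Site → Prop) : Prop where
  measurableSet : ∀ z, MeasurableSet {ξ | Q ξ z}
  step_iff : ∀ ξ z, Q ξ (step ξ z) ↔ Q ξ z
  congr : ∀ ξ ξ' z, (∀ w : Site, z.1.2 ≤ w.1.2 → ξ w = ξ' w) → Q ξ z → Q ξ' z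
  sub : ∀ ξ z, Q ξ z → ∃ K : ℕ, Sub K ξ z

variable {Q : Arrows → Site → Prop}

theorem IsPathProperty.siteAfter_iff (hQ : IsPathProperty Q) (ξ : Arrows) (z : Site) (n : ℕ) :
    Q ξ (siteAfter ξ z n) ↔ Q ξ z := by
  induction n with
  | zero => rfl
  | succ n ih => rw [siteAfter_succ', hQ.step_iff, ih]

theorem IsPathProperty.iff_of_coalesce (hQ : IsPathProperty Q) {ξ : Arrows} {z w : Site}
    (h : Coalesce ξ z w) : Q ξ z ↔ Q ξ w := by
  obtain ⟨n, hn⟩ := h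
  rw [← hQ.siteAfter_iff ξ z n, hn, hQ.siteAfter_iff]

theorem IsPathProperty.measurableSet_exists (hQ : IsPathProperty Q) :
    MeasurableSet {ξ | ∃ z, Q ξ z} := by
  have : {ξ | ∃ z, Q ξ z} = ⋃ z, {ξ | Q ξ z} := by ext; simp
  rw [this]
  exact MeasurableSet.iUnion hQ.measurableSet

/-- A witness `z` can be pushed along its path to level `m` or beyond, where the property depends on
later sites only. -/
theorem IsPathProperty.measure_zero_or_one (hQ : IsPathProperty Q) {J : Set ℝ}
    (hJ : MeasurableSet J) : dataLaw (existsTime {ξ | ∃ z, Q ξ z} J) = 0 ∨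
      dataLaw (existsTime {ξ | ∃ z, Q ξ z} J) = 1 := by
  have hne : Nonempty Clock := ⟨fun _ => (0, 1)⟩
  refine measure_zero_or_one_of_tail (fun _ : Site => clockLaw) (fun z => z.1.2)
    (fun ν _ => nullMeasurableSet_existsTime hQ.measurableSet_exists hJ ν) fun m => ?_
  have key : ∀ x y : Data, (∀ z ∈ {z : Site | m ≤ z.1.2}, x z = y z) →
      x ∈ existsTime {ξ | ∃ z, Q ξ z} J → y ∈ existsTime {ξ | ∃ z, Q ξ z} J := by
    rintro x y hxy ⟨τ, hτ, z, hz⟩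
    refine ⟨τ, hτ, siteAfter (arrowsOf x τ) z (m - z.1.2).toNat, ?_⟩
    refine hQ.congr (arrowsOf x τ) _ _ (fun w hw => ?_) ((hQ.siteAfter_iff _ _ _).2 hz)
    rw [siteAfter_snd] at hw
    have : m ≤ w.1.2 := by omega
    simp only [arrowsOf, hxy w this]
  exact fun x y hxy => ⟨key x y hxy, key y x fun z hz => (hxy z hz).symm⟩

/-- A witness from a negative level is first followed up to level 0, so that the path from the
origin has a site on its level to coalesce with. -/
theorem IsPathProperty.origin_of_exists (hQ : IsPathProperty Q) {ξ : Arrows}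
    (h : ∀ z w : Site, w.1.2 = z.1.2 → ∀ K : ℕ, Sub K ξ z → Coalesce ξ z w) {z : Site}
    (hz : Q ξ z) : Q ξ origin := by
  set v := siteAfter ξ z (-z.1.2).toNat
  have hv : Q ξ v := (hQ.siteAfter_iff _ _ _).2 hz
  have hv0 : 0 ≤ v.1.2 := by rw [siteAfter_snd]; omega
  obtain ⟨K, hK⟩ := hQ.sub ξ v hv
  have hc := h v (siteAfter ξ origin v.1.2.toNat) (by
    rw [siteAfter_snd]
    change (0 : ℤ) + _ = _
    omega) K hK
  rwa [hQ.iff_of_coalesce hc, hQ.siteAfter_iff] at hv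

theorem image_add_Ico (a c : ℝ) : (fun τ => a + τ) '' Set.Ico 0 c = Set.Ico a (a + c) := by
  simp [add_comm]

/-- A path property of the origin holds either almost surely at no dynamical time, or almost
surely at a dense set of dynamical times. -/
theorem IsPathProperty.dichotomy (hQ : IsPathProperty Q) :
    (∀ᵐ x ∂dataLaw, {τ : ℝ≥0 | Q (arrowsOf x τ) origin} = ∅) ∨
      ∀ᵐ x ∂dataLaw, Dense {τ : ℝ≥0 | Q (arrowsOf x τ) origin} := by
  set A : Set Arrows := {ξ | ∃ z, Q ξ z}
  by_cases h0 : dataLaw (existsTime A (Set.Ici 0)) = 0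
  · left
    filter_upwards [measure_eq_zero_iff_ae_notMem.1 h0] with x hx
    refine Set.eq_empty_of_forall_notMem fun τ hτ => hx ⟨τ, τ.2, origin, hτ⟩
  right
  have hcov : ∀ L : ℕ, Set.Ici (0 : ℝ) =
      ⋃ i : ℕ, Set.Ico (i / ((L : ℝ) + 1)) (i / ((L : ℝ) + 1) + 1 / ((L : ℝ) + 1)) := by
    intro L
    have hL : (0 : ℝ) < (L : ℝ) + 1 := by positivity
    ext τ
    simp only [Set.mem_Ici, Set.mem_iUnion, Set.mem_Ico]
    constructor
    · intro hτ
      have h1 := Nat.floor_le (mul_nonneg hτ hL.le)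
      have h2 := Nat.lt_floor_add_one (τ * ((L : ℝ) + 1))
      refine ⟨⌊τ * ((L : ℝ) + 1)⌋₊, ?_, ?_⟩
      · rwa [div_le_iff₀ hL]
      · rwa [← add_div, lt_div_iff₀ hL]
    · rintro ⟨i, hi, -⟩
      exact le_trans (by positivity) hi
  have hmeasure : ∀ (a c : ℝ), 0 ≤ a → dataLaw (existsTime A (Set.Ico a (a + c))) =
      dataLaw (existsTime A (Set.Ico 0 c)) := by
    intro a c ha
    rw [← image_add_Ico, ← measure_congr (preimage_shiftData_existsTime A
      Set.Ico_subset_Ici_self a)]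
    exact (measurePreserving_shiftData ha).measure_preimage
      (nullMeasurableSet_existsTime hQ.measurableSet_exists measurableSet_Ico _)
  have hone : ∀ L i : ℕ, dataLaw (existsTime A
      (Set.Ico (i / ((L : ℝ) + 1)) (i / ((L : ℝ) + 1) + 1 / ((L : ℝ) + 1)))) = 1 := by
    intro L i
    rw [hmeasure _ _ (by positivity)]
    -- If one window had probability 0, all windows of that length would, and countably many of them
    -- cover the half-line, contradicting `h0`.
    refine (hQ.measure_zero_or_one measurableSet_Ico).resolve_left fun hz => h0 ?_
    rw [hcov L, existsTime_iUnion, measure_iUnion_null_iff]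
    intro k
    rw [hmeasure _ _ (by positivity)]
    exact hz
  have hae : ∀ᵐ x ∂dataLaw, ∀ L i : ℕ, x ∈ existsTime A
      (Set.Ico (i / ((L : ℝ) + 1)) (i / ((L : ℝ) + 1) + 1 / ((L : ℝ) + 1))) := by
    simp only [ae_all_iff]
    intro L i
    refine (mem_ae_iff_prob_eq_one₀ ?_).2 (hone L i)
    exact nullMeasurableSet_existsTime hQ.measurableSet_exists measurableSet_Ico _
  filter_upwards [hae, ae_coalesce_of_sub] with x hx hc
  rw [Metric.dense_iff]
  intro σ r hr
  obtain ⟨L, hL⟩ := exists_nat_one_div_lt hr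
  have hσ : (σ : ℝ) ∈ Set.Ici (0 : ℝ) := σ.2
  rw [hcov L, Set.mem_iUnion] at hσ
  obtain ⟨i, hi⟩ := hσ
  obtain ⟨τ, hτ, z, hz⟩ := hx L i
  have hτ0 : 0 ≤ τ := le_trans (by positivity) hτ.1
  have hc' := hc τ hτ0
  lift τ to ℝ≥0 using hτ0
  refine ⟨τ, ?_, hQ.origin_of_exists hc' hz⟩
  rw [Metric.mem_ball, NNReal.dist_eq, abs_lt]
  constructor <;> linarith [hτ.1, hτ.2, hi.1, hi.2]

theorem sub_step_iff {K : ℝ} (hK : 0 ≤ K) (ξ : Arrows) (z : Site) :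
    Sub K ξ (step ξ z) ↔ Sub K ξ z := by
  constructor
  · rintro ⟨j, hj⟩
    refine ⟨j + z.1.1.natAbs, fun n => ?_⟩
    have hz : ((z.1.1.natAbs : ℕ) : ℝ) = |(z.1.1 : ℝ)| := by
      rw [Nat.cast_natAbs]; push_cast; rfl
    push_cast
    rw [hz]
    cases n with
    | zero =>
      simp [siteAfter]
    | succ n =>
      rw [siteAfter_succ]
      have h1 := hj n
      have h2 : K * √(n : ℝ) ≤ K * √((n + 1 : ℕ) : ℝ) :=
        mul_le_mul_of_nonneg_left (Real.sqrt_le_sqrt (by push_cast; linarith)) hK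
      have := abs_nonneg (z.1.1 : ℝ)
      linarith
  · rintro ⟨j, hj⟩
    obtain ⟨k, hk⟩ := exists_nat_ge K
    refine ⟨j + k, fun n => ?_⟩
    have h1 := hj (n + 1)
    rw [siteAfter_succ] at h1
    have h2 : √((n + 1 : ℕ) : ℝ) ≤ √(n : ℝ) + 1 := by
      rw [Real.sqrt_le_left (by positivity)]
      have h0 := Real.sq_sqrt (Nat.cast_nonneg (α := ℝ) n)
      have := Real.sqrt_nonneg (n : ℝ)
      push_cast
      nlinarith
    have h3 := mul_le_mul_of_nonneg_left h2 hK
    push_cast at h1 h3 ⊢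
    linarith

theorem siteAfter_congr {ξ ξ' : Arrows} {z : Site}
    (h : ∀ w : Site, z.1.2 ≤ w.1.2 → ξ w = ξ' w) (n : ℕ) :
    siteAfter ξ z n = siteAfter ξ' z n := by
  induction n with
  | zero => rfl
  | succ n ih =>
    rw [siteAfter_succ', siteAfter_succ', ih, step_eq_move, step_eq_move, h _ (by simp)]

theorem measurableSet_sub (K : ℝ) (z : Site) : MeasurableSet {ξ | Sub K ξ z} := by
  have : {ξ | Sub K ξ z} = ⋃ j : ℕ, ⋂ n : ℕ, (fun ξ => siteAfter ξ z n) ⁻¹'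
      {w | |(w.1.1 : ℝ)| ≤ j + K * √(n : ℝ)} := by
    ext; simp [Sub]
  rw [this]
  exact MeasurableSet.iUnion fun j => MeasurableSet.iInter fun n =>
    measurable_siteAfter z n (MeasurableSet.of_discrete)

theorem Sub.congr {K : ℝ} {ξ ξ' : Arrows} {z : Site}
    (h : ∀ w : Site, z.1.2 ≤ w.1.2 → ξ w = ξ' w) (hs : Sub K ξ z) : Sub K ξ' z := by
  obtain ⟨j, hj⟩ := hs
  exact ⟨j, fun n => by rw [← siteAfter_congr h]; exact hj n⟩

theorem Sub.mono {K K' : ℝ} (hK : K ≤ K') {ξ : Arrows} {z : Site} (hs : Sub K ξ z) :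
    Sub K' ξ z := by
  obtain ⟨j, hj⟩ := hs
  refine ⟨j, fun n => (hj n).trans ?_⟩
  gcongr

theorem isPathProperty_sub {K : ℝ} (hK : 0 ≤ K) : IsPathProperty (Sub K) where
  measurableSet := measurableSet_sub K
  step_iff := sub_step_iff hK
  congr _ _ _ h hs := hs.congr h
  sub _ _ hs := by
    obtain ⟨k, hk⟩ := exists_nat_ge K
    exact ⟨k, hs.mono hk⟩

/-- The path from `z` satisfies a `K'`-subdiffusive bound for every `K' > K`. -/
def LimSub (K : ℝ) (ξ : Arrows) (z : Site) : Prop := ∀ n : ℕ, Sub (K + 1 / (n + 1)) ξ z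

theorem isPathProperty_limSub {K : ℝ} (hK : 0 ≤ K) : IsPathProperty (LimSub K) where
  measurableSet z := by
    have : {ξ | LimSub K ξ z} = ⋂ n : ℕ, {ξ | Sub (K + 1 / (n + 1)) ξ z} := by
      ext; simp [LimSub]
    rw [this]
    exact MeasurableSet.iInter fun n => measurableSet_sub _ z
  step_iff ξ z := forall_congr' fun n => sub_step_iff (by positivity) ξ z
  congr _ _ _ h hs n := (hs n).congr h
  sub _ _ hs := by
    obtain ⟨k, hk⟩ := exists_nat_ge (K + 1 / ((0 : ℕ) + 1))
    exact ⟨k, (hs 0).mono hk⟩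

theorem LimSub.mono {K K' : ℝ} (hK : K ≤ K') {ξ : Arrows} {z : Site} (hs : LimSub K ξ z) :
    LimSub K' ξ z := fun n => (hs n).mono (by linarith)

/-- A monotone family of random sets, each almost surely empty or almost surely dense, consists
almost surely of sets that are empty or dense. -/
theorem ae_forall_empty_or_dense {Ω : Type*} [MeasurableSpace Ω] {P : Measure Ω}
    {X : Type*} [TopologicalSpace X] (S : Ω → ℝ → Set X)
    (hmono : ∀ ω K K', 0 < K → K ≤ K' → S ω K ⊆ S ω K')
    (hdich : ∀ K, 0 < K → (∀ᵐ ω ∂P, S ω K = ∅) ∨ ∀ᵐ ω ∂P, Dense (S ω K)) :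
    ∀ᵐ ω ∂P, ∀ K, 0 < K → S ω K = ∅ ∨ Dense (S ω K) := by
  set D : Set ℝ := {K | 0 < K ∧ ∀ᵐ ω ∂P, Dense (S ω K)}
  have hup : ∀ K K', K ∈ D → K ≤ K' → K' ∈ D := fun K K' hK hKK' =>
    ⟨hK.1.trans_le hKK', hK.2.mono fun ω h => h.mono (hmono ω K K' hK.1 hKK')⟩
  have hq : ∀ᵐ ω ∂P, ∀ q : ℚ, (0 : ℝ) < q →
      ((q : ℝ) ∈ D → Dense (S ω q)) ∧ ((q : ℝ) ∉ D → S ω q = ∅) := by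
    rw [ae_all_iff]
    intro q
    by_cases h0 : (0 : ℝ) < q
    · by_cases hD : (q : ℝ) ∈ D
      · filter_upwards [hD.2] with ω h _
        exact ⟨fun _ => h, fun h' => absurd hD h'⟩
      · rcases hdich q h0 with h | h
        · filter_upwards [h] with ω h _
          exact ⟨fun h' => absurd h' hD, fun _ => h⟩
        · exact absurd ⟨h0, h⟩ hD
    · exact ae_of_all _ fun ω h => absurd h h0
  -- Every other `K` is decided by monotonicity from a rational in `D` below it or a rational
  -- outside `D` above it; the critical value needs its own null set.
  have hinf : ∀ᵐ ω ∂P, 0 < sInf D → S ω (sInf D) = ∅ ∨ Dense (S ω (sInf D)) := by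
    by_cases h0 : 0 < sInf D
    · rcases hdich _ h0 with h | h
      · filter_upwards [h] with ω h _ using Or.inl h
      · filter_upwards [h] with ω h _ using Or.inr h
    · exact ae_of_all _ fun ω h => absurd h h0
  filter_upwards [hq, hinf] with ω hω hω' K hK
  by_cases h1 : ∃ q : ℚ, (0 : ℝ) < q ∧ (q : ℝ) ≤ K ∧ (q : ℝ) ∈ D
  · obtain ⟨q, hq0, hqK, hqD⟩ := h1
    exact Or.inr (((hω q hq0).1 hqD).mono (hmono ω q K hq0 hqK))
  by_cases h2 : ∃ q : ℚ, K ≤ (q : ℝ) ∧ (q : ℝ) ∉ D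
  · obtain ⟨q, hqK, hqD⟩ := h2
    refine Or.inl (Set.subset_eq_empty (hmono ω K q hK hqK) ((hω q (hK.trans_le hqK)).2 hqD))
  push Not at h1 h2
  have hlb : ∀ k ∈ D, K ≤ k := by
    intro k hk
    by_contra! hlt
    obtain ⟨q, hq1, hq2⟩ := exists_rat_btwn hlt
    exact h1 q (hk.1.trans hq1) hq2.le (hup k q hk hq1.le)
  have hKinf : K = sInf D := by
    refine le_antisymm (le_csInf ?_ hlb) (le_of_forall_gt_imp_ge_of_dense fun K' hK' => ?_)
    · obtain ⟨q, hq⟩ := exists_rat_gt K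
      exact ⟨q, h2 q hq.le⟩
    · obtain ⟨q, hq1, hq2⟩ := exists_rat_btwn hK'
      exact (csInf_le ⟨K, hlb⟩ (h2 q hq1.le)).trans hq2.le
  rw [hKinf] at hK ⊢
  exact hω' hK

end Dichotomy

/-! ### Reduction of the stated sets to lattice sites and the canonical law. -/

section Paths

theorem path_origin_eq (ξ : Arrows) (t : ℝ) :
    path ξ origin t = ((siteAfter ξ origin ⌊t⌋₊).1.1 : ℝ) +
      (t - ⌊t⌋₊) * ((ξ (siteAfter ξ origin ⌊t⌋₊) : ℤ) : ℝ) := by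
  simp [path, origin]

theorem path_origin_natCast (ξ : Arrows) (n : ℕ) :
    path ξ origin n = ((siteAfter ξ origin n).1.1 : ℝ) := by
  rw [path_origin_eq ξ n]
  simp

theorem abs_path_origin_le (ξ : Arrows) {t : ℝ} (ht : 0 ≤ t) :
    |path ξ origin t| ≤ |((siteAfter ξ origin ⌊t⌋₊).1.1 : ℝ)| + 1 := by
  rw [path_origin_eq ξ t]
  refine (abs_add_le _ _).trans (add_le_add le_rfl ?_)
  have h1 := Nat.floor_le ht
  have h2 := Nat.lt_floor_add_one t
  have h3 : |((ξ (siteAfter ξ origin ⌊t⌋₊) : ℤ) : ℝ)| = 1 := by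
    rcases unit_abs_le (ξ (siteAfter ξ origin ⌊t⌋₊)) with h | h <;> simp [h]
  rw [abs_mul, h3, mul_one, abs_le]
  constructor <;> linarith

theorem abs_siteAfter_origin_le (ξ : Arrows) (n : ℕ) :
    |((siteAfter ξ origin n).1.1 : ℝ)| ≤ n := by
  have : |(siteAfter ξ origin n).1.1| ≤ n := by
    induction n with
    | zero => simp [siteAfter, origin]
    | succ n ih =>
      rw [siteAfter_succ', step_eq_move, move_fst]
      have := unit_abs_le (ξ (siteAfter ξ origin n))
      push_cast
      grind
  exact_mod_cast this

/-- The walk moves at unit speed, so interpolation costs at most 1 and the times before `N` at most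
`N`; the additive constant absorbs both. -/
theorem sub_origin_iff {K : ℝ} (hK : 0 ≤ K) (ξ : Arrows) :
    Sub K ξ origin ↔ ∃ N j : ℕ, ∀ t : ℝ, (N : ℝ) ≤ t → |path ξ origin t| ≤ j + K * √t := by
  constructor
  · rintro ⟨j, hj⟩
    refine ⟨0, j + 1, fun t ht => ?_⟩
    rw [Nat.cast_zero] at ht
    have h1 := abs_path_origin_le ξ ht
    have h2 := hj ⌊t⌋₊
    have h3 : K * √(⌊t⌋₊ : ℝ) ≤ K * √t :=
      mul_le_mul_of_nonneg_left (Real.sqrt_le_sqrt (Nat.floor_le ht)) hK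
    push_cast
    linarith
  · rintro ⟨N, j, h⟩
    refine ⟨j + N, fun n => ?_⟩
    have h0 : 0 ≤ K * √(n : ℝ) := by positivity
    push_cast
    rcases le_total N n with hn | hn
    · have := h n (by exact_mod_cast hn)
      rw [path_origin_natCast] at this
      have : (0 : ℝ) ≤ N := Nat.cast_nonneg N
      linarith
    · have h1 := abs_siteAfter_origin_le ξ n
      have h2 : (n : ℝ) ≤ N := by exact_mod_cast hn
      have : (0 : ℝ) ≤ j := Nat.cast_nonneg j
      linarith

theorem limSub_origin_iff {K : ℝ} (hK : 0 ≤ K) (ξ : Arrows) :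
    LimSub K ξ origin ↔
      limsup (fun t : ℝ => ((|path ξ origin t| / √t : ℝ) : EReal)) atTop ≤ (K : EReal) := by
  constructor
  · intro h
    refine le_of_forall_gt_imp_ge_of_dense fun a ha => ?_
    obtain ⟨c, hc1, hc2⟩ := EReal.lt_iff_exists_real_btwn.1 ha
    rw [EReal.coe_lt_coe_iff] at hc1
    refine le_trans ?_ hc2.le
    obtain ⟨n, hn⟩ := exists_nat_one_div_lt (sub_pos.2 hc1)
    obtain ⟨N, j, hNj⟩ := (sub_origin_iff (by positivity) ξ).1 (h n)
    -- The slack `ε` absorbs the additive constant `j` once `√t ≥ j / ε`.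
    set ε := c - K - 1 / ((n : ℝ) + 1) with hε
    have hε0 : 0 < ε := by linarith
    have hlim : Tendsto (fun t : ℝ => √t) atTop atTop := Real.tendsto_sqrt_atTop
    refine limsup_le_of_le (by isBoundedDefault) ?_
    filter_upwards [eventually_ge_atTop (N : ℝ), hlim.eventually_ge_atTop (j / ε),
      eventually_gt_atTop 0] with t ht1 ht2 ht3
    rw [EReal.coe_le_coe_iff, div_le_iff₀ (Real.sqrt_pos.2 ht3)]
    have h1 := hNj t ht1
    rw [div_le_iff₀ hε0] at ht2
    have h2 : c = ε + (K + 1 / ((n : ℝ) + 1)) := by rw [hε]; ring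
    rw [h2]
    linarith
  · intro h n
    rw [sub_origin_iff (by positivity)]
    have hlt : limsup (fun t : ℝ => ((|path ξ origin t| / √t : ℝ) : EReal)) atTop <
        ((K + 1 / ((n : ℝ) + 1) : ℝ) : EReal) := by
      refine h.trans_lt ?_
      rw [EReal.coe_lt_coe_iff]
      have : (0 : ℝ) < 1 / ((n : ℝ) + 1) := by positivity
      linarith
    have hev := eventually_lt_of_limsup_lt hlt
    obtain ⟨T, hT⟩ := eventually_atTop.1 (hev.and (eventually_gt_atTop 0))
    obtain ⟨N, hN⟩ := exists_nat_ge T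
    refine ⟨N, 0, fun t ht => ?_⟩
    obtain ⟨h1, h2⟩ := hT t (hN.trans ht)
    rw [EReal.coe_lt_coe_iff, div_lt_iff₀ (Real.sqrt_pos.2 h2)] at h1
    simpa using h1.le

/-- The data formed by given waiting times and arrows. -/
def toData (wait : Site → ℕ → ℝ) (mark : Site → ℕ → ℤˣ) : Data :=
  fun z n => (wait z n, mark z n)

theorem arrowsAt_eq {wait : Site → ℕ → ℝ} {mark : Site → ℕ → ℤˣ}
    (h : ∀ z, GoodClock (toData wait mark z)) (τ : ℝ≥0) :
    arrowsAt wait mark τ = arrowsOf (toData wait mark) τ := by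
  funext z
  have := (h z).ringCount_eq τ
  simp only [arrowsAt, arrowsOf, arrowAt]
  rw [← this]
  rfl

theorem eventuallySubdiffusive_eq {wait : Site → ℕ → ℝ} {mark : Site → ℕ → ℤˣ}
    (h : ∀ z, GoodClock (toData wait mark z)) {K : ℝ} (hK : 0 ≤ K) :
    eventuallySubdiffusive wait mark K =
      {τ : ℝ≥0 | Sub K (arrowsOf (toData wait mark) τ) origin} := by
  ext τ
  simp only [eventuallySubdiffusive, Set.mem_ofPred_eq, originPath, arrowsAt_eq h,
    sub_origin_iff hK]

theorem limitSubdiffusive_eq {wait : Site → ℕ → ℝ} {mark : Site → ℕ → ℤˣ}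
    (h : ∀ z, GoodClock (toData wait mark z)) {K : ℝ} (hK : 0 ≤ K) :
    limitSubdiffusive wait mark K =
      {τ : ℝ≥0 | LimSub K (arrowsOf (toData wait mark) τ) origin} := by
  ext τ
  simp only [limitSubdiffusive, Set.mem_ofPred_eq, originPath, arrowsAt_eq h,
    limSub_origin_iff hK]

theorem IsDriving.hasLaw_toData {Ω : Type*} [MeasurableSpace Ω] {P : Measure Ω}
    {wait : Site → ℕ → Ω → ℝ} {mark : Site → ℕ → Ω → ℤˣ} (h : IsDriving P wait mark) :
    HasLaw (fun ω => toData (fun z n => wait z n ω) (fun z n => mark z n ω)) dataLaw P := by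
  have hl : ∀ i : Site × ℕ, HasLaw (fun ω => (wait i.1 i.2 ω, mark i.1 i.2 ω)) tickLaw P :=
    fun i => h.law i.1 i.2
  have h1 := h.indep.hasLaw_infinitePi hl (aemeasurable_pi_lambda _ fun i => (hl i).aemeasurable)
  have h2 := Measure.infinitePi_map_curry (fun (_ : Site) (_ : ℕ) => tickLaw)
  have hm := (MeasurableEquiv.curry Site ℕ (ℝ × ℤˣ)).measurable
  refine ⟨hm.comp_aemeasurable h1.aemeasurable, ?_⟩
  rw [← h1.map_eq, AEMeasurable.map_map_of_aemeasurable hm.aemeasurable h1.aemeasurable] at h2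
  exact h2

end Paths

end DyDW

theorem mainTheorem11 {Ω : Type*} [MeasurableSpace Ω] (P : Measure Ω) [IsProbabilityMeasure P]
    (wait : DyDW.Site → ℕ → Ω → ℝ) (mark : DyDW.Site → ℕ → Ω → ℤˣ)
    (h : DyDW.IsDriving P wait mark) :
    ∀ᵐ ω ∂P, ∀ K : ℝ, 0 < K →
      (DyDW.eventuallySubdiffusive (fun z n => wait z n ω) (fun z n => mark z n ω) K = ∅ ∨
        Dense (DyDW.eventuallySubdiffusive (fun z n => wait z n ω) (fun z n => mark z n ω) K)) ∧
      (DyDW.limitSubdiffusive (fun z n => wait z n ω) (fun z n => mark z n ω) K = ∅ ∨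
        Dense (DyDW.limitSubdiffusive (fun z n => wait z n ω) (fun z n => mark z n ω) K)) := by
  have h1 := DyDW.ae_forall_empty_or_dense (P := DyDW.dataLaw)
    (fun x K => {τ : ℝ≥0 | DyDW.Sub K (DyDW.arrowsOf x τ) DyDW.origin})
    (fun x K K' _ hKK' τ hτ => DyDW.Sub.mono hKK' hτ)
    (fun K hK => (DyDW.isPathProperty_sub hK.le).dichotomy)
  have h2 := DyDW.ae_forall_empty_or_dense (P := DyDW.dataLaw)
    (fun x K => {τ : ℝ≥0 | DyDW.LimSub K (DyDW.arrowsOf x τ) DyDW.origin})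
    (fun x K K' _ hKK' τ hτ => DyDW.LimSub.mono hKK' hτ)
    (fun K hK => (DyDW.isPathProperty_limSub hK.le).dichotomy)
  have hlaw := h.hasLaw_toData
  have hall := h1.and (h2.and DyDW.ae_goodData)
  rw [← hlaw.map_eq] at hall
  filter_upwards [ae_of_ae_map hlaw.aemeasurable hall] with ω hω K hK
  obtain ⟨hs, hl, hg⟩ := hω
  rw [DyDW.eventuallySubdiffusive_eq hg hK.le, DyDW.limitSubdiffusive_eq hg hK.le]
  exact ⟨hs K hK, hl K hK⟩
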